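/- **Setting.** Algorithms are programs for a randomized random access machine with unit-cost addition, (truncated) subtraction, comparison with $0$, indirect memory access and fair coin tosses (a model polynomially equivalent to randomized Turing machines); running times are worst case over the coin tosses. Deterministic algorithms are the special case in which no coin is tossed. **gap-ETH.** There are constants $B\in\mathbb N$ and $\varepsilon',\tau>0$ such that no randomized algorithm that runs in time $O(2^{\tau N})$ on every 3-SAT formula $\phi$ with $N$ variables and $M$ clauses in which each variable occurs in at most $B$ clauses distinguishes, correctly with probability at least $2/3$, the case that some assignment satisfies all $M$ clauses of $\phi$ from the case that every assignment satisfies $<(1-\varepsilon')M$ clauses of $\phi$. **Uniform Capacitated Sum of Radii.** An instance $((P,\delta),k,U)$ consists of a nonempty finite metric space $(P,\delta)$ (with integer distances), an integer $k\ge 1$ and a capacity $U\in\mathbb N$. A feasible solution is a pair $(S,\sigma)$ with $S\subseteq P$, $|S|\le k$, $\sigma:P\to S$ and $|\sigma^{-1}(s)|\le U$ for every $s\in S$; its cost is $\sum_{s\in S}\mathrm{rad}(s)$, where $\mathrm{rad}(s)=\max_{p\in\sigma^{-1}(s)}\delta(p,s)$ (and $0$ if $\sigma^{-1}(s)=\emptyset$).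 For $\alpha\geq 1$, an $\alpha$-approximation algorithm outputs, with probability at least $2/3$ on each instance that has a feasible solution, a feasible solution of cost at most $\alpha$ times the minimum. Let $n$ denote the bit length of the instance (so $n\ge |P|$, and excluding a running time $f(k)\,n^{o(k)}$ also excludes $f(k)\,|P|^{o(k)}$). **Theorem (No FPT-AS).** Assume gap-ETH. Then there is a fixed $\alpha>1$ such that for no functions $f,e:\mathbb N\to\mathbb R$ with $e(k)=o(k)$ as $k\to\infty$ does there exist an $\alpha$-approximation algorithm for Uniform Capacitated Sum of Radii that runs in time $f(k)\,n^{e(k)}$ on every instance that has a feasible solution. In particular there is no FPT approximation scheme: there are no functions $f(k,\varepsilon)$ and $g(\varepsilon)$ such that for every $\varepsilon>0$ there is a $(1+\varepsilon)$-approximation algorithm that runs in time $f(k,\varepsilon)\,n^{g(\varepsilon)}$ on every instance that has a feasible solution. -/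

import Mathlib

open MeasureTheory Filter Asymptotics

/-! ### Machine model

A randomized random access machine, as a structured programming language.  The memory consists of
arrays of natural numbers; each program names finitely many arrays, and indices are computed at
run time.  The arithmetic is addition and truncated subtraction, so that with the costs below (one
unit per elementary operation, the usual uniform cost measure) the model is polynomially equivalent
to Turing machines with access to random bits. -/

namespace RAM

/-- `m a i` is the content of cell `i` of array `a`. -/
abbrev Memory := ℕ → ℕ → ℕ

/-- An infinite sequence of coin tosses. -/
abbrev Coins := ℕ → Bool

/-- Arithmetic expressions; `read a i` is the content of cell `i` of array `a`. -/
inductive Expr where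
  | const (n : ℕ) : Expr
  | read (a : ℕ) (i : Expr) : Expr
  | add (x y : Expr) : Expr
  | sub (x y : Expr) : Expr

/-- The value of an expression. -/
def Expr.eval (m : Memory) : Expr → ℕ
  | .const n => n
  | .read a i => m a (i.eval m)
  | .add x y => x.eval m + y.eval m
  | .sub x y => x.eval m - y.eval m

/-- The number of elementary operations that the evaluation of an expression takes. -/
def Expr.cost : Expr → ℕ
  | .const _ => 1
  | .read _ i => i.cost + 1
  | .add x y => x.cost + y.cost + 1
  | .sub x y => x.cost + y.cost + 1

/-- Programs. -/
inductive Cmd where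
  /-- do nothing -/
  | skip : Cmd
  /-- write the value of `x` to cell `i` of array `a` -/
  | store (a : ℕ) (i x : Expr) : Cmd
  /-- toss a fair coin and write the result (`0` or `1`) to cell `i` of array `a` -/
  | toss (a : ℕ) (i : Expr) : Cmd
  /-- do `c`, then `d` -/
  | seq (c d : Cmd) : Cmd
  /-- if `x` is nonzero do `c`, otherwise do `d` -/
  | cond (x : Expr) (c d : Cmd) : Cmd
  /-- as long as `x` is nonzero do `c` -/
  | loop (x : Expr) (c : Cmd) : Cmd

/-- A memory content together with the number of coins tossed so far. -/
structure State where
  mem : Memory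
  pos : ℕ

/-- The memory `m` after `v` has been written to cell `i` of array `a`. -/
def Memory.write (m : Memory) (a i v : ℕ) : Memory :=
  fun b j => if b = a ∧ j = i then v else m b j

/-- `Exec ω c s s' t`: with coin tosses `ω`, the program `c` started in state `s` halts in
state `s'` after exactly `t` steps. -/
inductive Exec (ω : Coins) : Cmd → State → State → ℕ → Prop where
  | skip (s : State) : Exec ω .skip s s 1
  | store (a : ℕ) (i x : Expr) (s : State) :
      Exec ω (.store a i x) s ⟨s.mem.write a (i.eval s.mem) (x.eval s.mem), s.pos⟩
        (i.cost + x.cost + 1)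
  | toss (a : ℕ) (i : Expr) (s : State) :
      Exec ω (.toss a i) s
        ⟨s.mem.write a (i.eval s.mem) (if ω s.pos then 1 else 0), s.pos + 1⟩ (i.cost + 1)
  | seq {c d : Cmd} {s s' s'' : State} {t t' : ℕ} :
      Exec ω c s s' t → Exec ω d s' s'' t' → Exec ω (.seq c d) s s'' (t + t')
  | cond_true {x : Expr} {c d : Cmd} {s s' : State} {t : ℕ} :
      x.eval s.mem ≠ 0 → Exec ω c s s' t → Exec ω (.cond x c d) s s' (x.cost + t + 1)
  | cond_false {x : Expr} {c d : Cmd} {s s' : State} {t : ℕ} :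
      x.eval s.mem = 0 → Exec ω d s s' t → Exec ω (.cond x c d) s s' (x.cost + t + 1)
  | loop_true {x : Expr} {c : Cmd} {s s' s'' : State} {t t' : ℕ} :
      x.eval s.mem ≠ 0 → Exec ω c s s' t → Exec ω (.loop x c) s' s'' t' →
      Exec ω (.loop x c) s s'' (x.cost + t + t' + 1)
  | loop_false {x : Expr} {c : Cmd} {s : State} :
      x.eval s.mem = 0 → Exec ω (.loop x c) s s (x.cost + 1)

/-- The initial state: array `0` holds the input, all other cells are `0`, no coin is tossed. -/
def init (input : List ℕ) : State :=
  ⟨fun a i => if a = 0 then input.getD i 0 else 0, 0⟩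

/-- On the given input and with coin tosses `ω`, the program halts within `T` steps, and the final
memory content satisfies `Q`. -/
def Yields (c : Cmd) (input : List ℕ) (ω : Coins) (T : ℝ) (Q : Memory → Prop) : Prop :=
  ∃ (s : State) (t : ℕ), Exec ω c (init input) s t ∧ (t : ℝ) ≤ T ∧ Q s.mem

/-- Whatever the coin tosses are, the program halts within `T` steps on the given input. -/
def HaltsWithin (c : Cmd) (input : List ℕ) (T : ℝ) : Prop :=
  ∀ ω : Coins, Yields c input ω T fun _ => True

/-- The law of a sequence of independent fair coin tosses. -/
noncomputable def coinMeasure : Measure Coins :=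
  Measure.infinitePi fun _ : ℕ => (PMF.uniformOfFintype Bool).toMeasure

/-- With probability at least `2/3`, the program halts within `T` steps on the given input, with
a final memory content that satisfies `Q`. -/
def LikelyYields (c : Cmd) (input : List ℕ) (T : ℝ) (Q : Memory → Prop) : Prop :=
  (2 / 3 : ENNReal) ≤ coinMeasure {ω | Yields c input ω T Q}

end RAM

/-! ### Bounded occurrence 3-SAT and the gap exponential time hypothesis -/

/-- A 3-SAT formula with `N` variables and `M` clauses (listed, so that a clause may be repeated).
A clause is a disjunction of three literals, which need not be distinct; a literal is a variable
together with the truth value that satisfies it. -/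
structure Formula where
  N : ℕ
  M : ℕ
  clause : Fin M → Fin 3 → Fin N × Bool

namespace Formula

/-- The number of clauses in which the variable `v` occurs. -/
def occurrences (φ : Formula) (v : Fin φ.N) : ℕ :=
  (Finset.univ.filter fun j : Fin φ.M => ∃ l, (φ.clause j l).1 = v).card

/-- The number of clauses that the assignment `a` satisfies. -/
def satCount (φ : Formula) (a : Fin φ.N → Bool) : ℕ :=
  (Finset.univ.filter fun j : Fin φ.M => ∃ l, a (φ.clause j l).1 = (φ.clause j l).2).card

/-- The formula as a list of numbers: `N`, `M`, and then for every clause its three literals, each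
as the number of the variable followed by the sign. -/
def encode (φ : Formula) : List ℕ :=
  [φ.N, φ.M] ++ (List.ofFn fun j => (List.ofFn fun l =>
    [((φ.clause j l).1 : ℕ), (φ.clause j l).2.toNat]).flatten).flatten

end Formula

/-- Within time `T φ` on every 3-SAT formula `φ` in which each variable occurs in at most `B`
clauses, the program `c` distinguishes with probability at least `2/3` the satisfiable formulas
(cell `0` of array `1` is nonzero in the end) from those of which every assignment satisfies less
than a fraction `1 - ε` of the clauses (cell `0` of array `1` is zero in the end). -/
def Distinguishes (c : RAM.Cmd) (B : ℕ) (ε : ℝ) (T : Formula → ℝ) : Prop :=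
  ∀ φ : Formula, (∀ v, φ.occurrences v ≤ B) →
    RAM.HaltsWithin c φ.encode (T φ) ∧
    ((∃ a, φ.satCount a = φ.M) →
      RAM.LikelyYields c φ.encode (T φ) fun m => m 1 0 ≠ 0) ∧
    ((∀ a, (φ.satCount a : ℝ) < (1 - ε) * φ.M) →
      RAM.LikelyYields c φ.encode (T φ) fun m => m 1 0 = 0)

/-- The (randomized) gap exponential time hypothesis: for some constants `B`, `ε`, `τ`, no
randomized algorithm distinguishes in time `O(2 ^ (τ N))`. -/
def GapETH : Prop :=
  ∃ (B : ℕ) (ε τ : ℝ), 0 < ε ∧ 0 < τ ∧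
    ¬ ∃ (c : RAM.Cmd) (C : ℝ), Distinguishes c B ε fun φ => C * (2 : ℝ) ^ (τ * (φ.N : ℝ))

/-! ### Uniform capacitated sum of radii -/

/-- An instance: a nonempty finite metric space `Fin n` with integral distances, the number `k ≥ 1`
of clusters, and the uniform capacity `U`. -/
structure CapSoR where
  n : ℕ
  k : ℕ
  U : ℕ
  dist : Fin n → Fin n → ℕ
  n_pos : 0 < n
  k_pos : 0 < k
  dist_eq_zero : ∀ p q, dist p q = 0 ↔ p = q
  dist_comm : ∀ p q, dist p q = dist q p
  dist_triangle : ∀ p q r, dist p r ≤ dist p q + dist q r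

namespace CapSoR

/-- A candidate solution: a set `S` of centers and an assignment `σ` of points to points. -/
structure Solution (I : CapSoR) where
  S : Finset (Fin I.n)
  σ : Fin I.n → Fin I.n

/-- The cluster of points that are assigned to `s`. -/
def Solution.cluster {I : CapSoR} (x : I.Solution) (s : Fin I.n) : Finset (Fin I.n) :=
  Finset.univ.filter fun p => x.σ p = s

/-- Every point is assigned to a center, there are at most `k` centers, and at most `U` points are
assigned to each of them. -/
def Solution.Feasible {I : CapSoR} (x : I.Solution) : Prop :=
  (∀ p, x.σ p ∈ x.S) ∧ x.S.card ≤ I.k ∧ ∀ s ∈ x.S, (x.cluster s).card ≤ I.U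

/-- The radius of the cluster of `s`: the largest distance of one of its points to `s` (`0` if the
cluster is empty). -/
def Solution.rad {I : CapSoR} (x : I.Solution) (s : Fin I.n) : ℕ :=
  (x.cluster s).sup fun p => I.dist p s

/-- The sum of the radii. -/
def Solution.cost {I : CapSoR} (x : I.Solution) : ℕ :=
  ∑ s ∈ x.S, x.rad s

/-- A feasible solution whose cost is at most `α` times that of any feasible solution. -/
def Solution.IsApprox {I : CapSoR} (α : ℝ) (x : I.Solution) : Prop :=
  x.Feasible ∧ ∀ y : I.Solution, y.Feasible → (x.cost : ℝ) ≤ α * (y.cost : ℝ)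

/-- The instance as a list of numbers: `n`, `k`, `U`, and the rows of the distance matrix. -/
def encode (I : CapSoR) : List ℕ :=
  [I.n, I.k, I.U] ++ (List.ofFn fun p => List.ofFn fun q => I.dist p q).flatten

/-- The size of an instance: the bit length of its encoding, with one delimiter for each number.
It is at least the number of points. -/
def size (I : CapSoR) : ℕ :=
  (I.encode.map fun x => Nat.size x + 1).sum

/-- The memory content `m` describes the solution `x`: array `1` holds the assignment, and the
nonzero cells of array `2` mark the centers. -/
def Solution.Describes {I : CapSoR} (x : I.Solution) (m : RAM.Memory) : Prop :=
  ∀ p : Fin I.n, m 1 p = (x.σ p : ℕ) ∧ (m 2 p ≠ 0 ↔ p ∈ x.S)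

end CapSoR

/-- The program `c` is a (randomized) `α`-approximation algorithm for uniform capacitated sum of
radii that runs in time `T I`: on each instance `I` that has a feasible solution, it always halts
within `T I` steps, and with probability at least `2/3` its output is an `α`-approximate solution.
(Nothing is asked on infeasible instances.) -/
def ApproximatesCapSoR (c : RAM.Cmd) (α : ℝ) (T : CapSoR → ℝ) : Prop :=
  ∀ I : CapSoR, (∃ y : I.Solution, y.Feasible) →
    RAM.HaltsWithin c I.encode (T I) ∧
    RAM.LikelyYields c I.encode (T I) fun m =>
      ∃ x : I.Solution, x.Describes m ∧ x.IsApprox α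

/-- An FPT approximation scheme: for every `ε > 0` a `(1 + ε)`-approximation algorithm that runs in
time `f(k, ε) n ^ g(ε)`, for fixed functions `f` and `g`. -/
def HasFPTApproximationScheme : Prop :=
  ∃ (f : ℕ → ℝ → ℝ) (g : ℝ → ℝ), ∀ ε : ℝ, 0 < ε →
    ∃ c : RAM.Cmd, ApproximatesCapSoR c (1 + ε) fun I => f I.k ε * (I.size : ℝ) ^ g ε

/-!
The theorem is proved by a gap-preserving reduction from bounded occurrence 3-SAT that compresses
`N` variables into `k` clusters, for a constant `k`.

*The instance.*  Distribute the `M` clauses cyclically into `K = min k (M + 1)` groups, and let each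
variable be owned by the group of its last occurrence.  Row `i` of the instance has one candidate
center for each of the `L = 2 ^ O(M / K)` assignments to the variables of group `i`, and private
points that are adjacent only to the candidate centers of the row.  Moreover there are many copies
of every clause, adjacent to the candidate centers that satisfy it, and copies of trivial clauses,
adjacent to all candidate centers.  Adjacent points have distance `1` and all others `2`.  The
capacities are tight: they add up to the number of points.  So every cluster of a feasible solution
is full, has radius at least `1`, and the cost is at least `K` plus the number of clusters with a
point at distance `2` from the center (`Solution.Feasible.le_cost`).

*The gap.*  A satisfying assignment gives a solution of cost `K`: it selects one candidate center in
each row, each clause goes to a row that satisfies it, and the trivial clauses fill up the clusters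
(`SlotTable.exists_solution_of_sat`).  Conversely, a cluster of radius `1` that is full has a
candidate center, and a row without such a cluster must have its private points in clusters of
radius `2`.  So if these are few, almost every row has a cluster of radius `1`; as there are only
`K` clusters, almost all clusters of radius `1` belong to one candidate center for each row, and
together these satisfy almost all clauses (`Sizes.exists_cover`, `SlotTable.exists_assignment`).
Thus a factor `1 + 1 / Q`, for a constant `Q`, separates the two cases.

*The running time.*  The instance has `2 ^ O(N / k)` points, and it has `K = k` unless it has bounded
size.  An algorithm that takes time `f k * n ^ o(k)` takes time `O(2 ^ (o(1) * N))` on it, and a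
reduction in time polynomial in the size of the instance takes time `2 ^ O(N / k)`, where the
constant in the exponent does not depend on `k`.  So for a large constant `k` both are
`O(2 ^ (τ * N))` (`exists_time_bound`).

*The program.*  The reduction has to be a program of the random access machine.  It is written in a
functional term language with bounded loops, in which correctness is a matter of evaluation, and
which compiles to the machine (`RAM.Tm.compile_spec`).  The running time of a term is polynomial in a
bound on the number of iterations of its loops (`RAM.Tm.time_le_poly`), so that it suffices to bound
all loops by a polynomial in the number of points.  The reduction itself tosses no coins; the given
approximation algorithm runs on a separate block of arrays (`RAM.Exec.shift`), and its output leads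
to the right answer whenever it is approximately optimal, hence with probability at least `2 / 3`.
-/

/-! ### A term language with bounded loops, and its compilation -/

namespace RAM

/-- The environment `ρ` with the value `v` pushed in front. -/
def push (v : ℕ) (ρ : ℕ → ℕ) : ℕ → ℕ
  | 0 => v
  | i + 1 => ρ i

@[simp] theorem push_zero (v : ℕ) (ρ : ℕ → ℕ) : push v ρ 0 = v := rfl
@[simp] theorem push_succ (v : ℕ) (ρ : ℕ → ℕ) (i : ℕ) : push v ρ (i + 1) = ρ i := rfl
@[simp] theorem push_one (v : ℕ) (ρ : ℕ → ℕ) : push v ρ 1 = ρ 0 := rfl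

/-- Terms of a functional language with bounded loops, with de Bruijn variables.  Array `2` is the
work space of the compiled code, so that terms may read all arrays but this one. -/
inductive Tm where
  | var (i : ℕ) : Tm
  | const (n : ℕ) : Tm
  | read (a : ℕ) (h : a ≠ 2) (x : Tm) : Tm
  | add (x y : Tm) : Tm
  | sub (x y : Tm) : Tm
  /-- the value of `y` if that of `x` is nonzero, and that of `z` otherwise -/
  | ite (x y z : Tm) : Tm
  /-- start with the value of `z` and apply `s` as often as the value of `n` says; in `s`, variable
  `0` is the value so far and variable `1` counts the iterations -/
  | fold (n z s : Tm) : Tm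
  /-- the term `x` with variable `i` replaced by variable `g i` -/
  | ren (g : ℕ → ℕ) (x : Tm) : Tm

namespace Tm

/-- The value of a term in the memory `m` and the environment `ρ`. -/
def eval (m : Memory) : Tm → (ℕ → ℕ) → ℕ
  | var i, ρ => ρ i
  | const n, _ => n
  | read a _ x, ρ => m a (x.eval m ρ)
  | add x y, ρ => x.eval m ρ + y.eval m ρ
  | sub x y, ρ => x.eval m ρ - y.eval m ρ
  | ite x y z, ρ => if x.eval m ρ ≠ 0 then y.eval m ρ else z.eval m ρ
  | fold n z s, ρ =>
      Nat.rec (z.eval m ρ) (fun i v => s.eval m (push v (push i ρ))) (n.eval m ρ)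
  | ren g x, ρ => x.eval m fun i => ρ (g i)

/-- The value of the loop `fold n z s` after `j` iterations. -/
def iter (m : Memory) (z s : Tm) (ρ : ℕ → ℕ) (j : ℕ) : ℕ :=
  Nat.rec (z.eval m ρ) (fun i v => s.eval m (push v (push i ρ))) j

/-- In the evaluation of the term, no loop has more than `V` iterations. -/
def Bdd (V : ℕ) (m : Memory) : Tm → (ℕ → ℕ) → Prop
  | var _, _ => True
  | const _, _ => True
  | read _ _ x, ρ => x.Bdd V m ρ
  | add x y, ρ => x.Bdd V m ρ ∧ y.Bdd V m ρ
  | sub x y, ρ => x.Bdd V m ρ ∧ y.Bdd V m ρ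
  | ite x y z, ρ => x.Bdd V m ρ ∧ y.Bdd V m ρ ∧ z.Bdd V m ρ
  | fold n z s, ρ => n.Bdd V m ρ ∧ z.Bdd V m ρ ∧ n.eval m ρ ≤ V ∧
      ∀ j < n.eval m ρ, s.Bdd V m (push (iter m z s ρ j) (push j ρ))
  | ren g x, ρ => x.Bdd V m fun i => ρ (g i)

/-- A bound on the running time of the compiled term when no loop has more than `V` iterations. -/
def time (V : ℕ) : Tm → ℕ
  | var _ => 4
  | const _ => 3
  | read _ _ x => x.time V + 5
  | add x y => x.time V + y.time V + 7
  | sub x y => x.time V + y.time V + 7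
  | ite x y z => x.time V + y.time V + z.time V + 3
  | fold n z s => n.time V + z.time V + V * (s.time V + 16) + 9
  | ren _ x => x.time V

/-- Cell `i` of the work space. -/
abbrev tmp (i : ℕ) : Expr := .read 2 (.const i)

/-- The cells of the work space that hold the variables of a loop body: the value so far in cell
`d`, the counter in cell `d + 2`. -/
def loopCells (d : ℕ) (κ : ℕ → ℕ) : ℕ → ℕ := push d (push (d + 2) κ)

/-- A program that computes the term `x` into cell `d` of the work space, provided that cell `κ i`
holds the value of variable `i`.  It uses no cell below `d` otherwise. -/
def compile : Tm → ℕ → (ℕ → ℕ) → Cmd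
  | var i, d, κ => .store 2 (.const d) (tmp (κ i))
  | const n, d, _ => .store 2 (.const d) (.const n)
  | read a _ x, d, κ => .seq (x.compile d κ) (.store 2 (.const d) (.read a (tmp d)))
  | add x y, d, κ => .seq (x.compile d κ) (.seq (y.compile (d + 1) κ)
      (.store 2 (.const d) (.add (tmp d) (tmp (d + 1)))))
  | sub x y, d, κ => .seq (x.compile d κ) (.seq (y.compile (d + 1) κ)
      (.store 2 (.const d) (.sub (tmp d) (tmp (d + 1)))))
  | ite x y z, d, κ => .seq (x.compile d κ) (.cond (tmp d) (y.compile d κ) (z.compile d κ))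
  | fold n z s, d, κ => .seq (z.compile d κ) (.seq (n.compile (d + 1) κ)
      (.seq (.store 2 (.const (d + 2)) (.const 0))
        (.loop (.sub (tmp (d + 1)) (tmp (d + 2)))
          (.seq (s.compile (d + 3) (loopCells d κ))
            (.seq (.store 2 (.const d) (tmp (d + 3)))
              (.store 2 (.const (d + 2)) (.add (tmp (d + 2)) (.const 1))))))))
  | ren g x, d, κ => x.compile d fun i => κ (g i)

/-- The code of a term is correct and respects the time bound. -/
theorem compile_spec (ω : Coins) (pos V : ℕ) (m₀ : Memory) (x : Tm) :
    ∀ (d : ℕ) (κ ρ : ℕ → ℕ) (m : Memory), (∀ i, κ i < d) → (∀ a, a ≠ 2 → m a = m₀ a) →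
      (∀ i, m 2 (κ i) = ρ i) → x.Bdd V m₀ ρ →
      ∃ (m' : Memory) (t : ℕ), Exec ω (x.compile d κ) ⟨m, pos⟩ ⟨m', pos⟩ t ∧ t ≤ x.time V ∧
        m' 2 d = x.eval m₀ ρ ∧ (∀ a, a ≠ 2 → m' a = m₀ a) ∧ ∀ i < d, m' 2 i = m 2 i := by
  have wr : ∀ (m : Memory) (i v : ℕ), (∀ a, a ≠ 2 → m a = m₀ a) →
      ∀ a, a ≠ 2 → m.write 2 i v a = m₀ a := by
    intro m i v h a ha
    rw [← h a ha]
    funext j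
    simp [Memory.write, ha]
  have wr2 : ∀ (m : Memory) (i v j : ℕ), m.write 2 i v 2 j = if j = i then v else m 2 j := by
    intro m i v j
    simp [Memory.write]
  induction x with
  | var i =>
    intro d κ ρ m hκ hm hρ _
    refine ⟨_, _, .store _ _ _ _, le_rfl, ?_, wr _ _ _ hm, ?_⟩
    · simp [Expr.eval, eval, wr2, hρ]
    · intro j hj
      simp [Expr.eval, wr2, hj.ne]
  | const n =>
    intro d κ ρ m hκ hm hρ _
    refine ⟨_, _, .store _ _ _ _, le_rfl, ?_, wr _ _ _ hm, ?_⟩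
    · simp [Expr.eval, eval, wr2]
    · intro j hj
      simp [Expr.eval, wr2, hj.ne]
  | read a h x ih =>
    intro d κ ρ m hκ hm hρ hb
    obtain ⟨m', t, hx, ht, hv, hm', hlow⟩ := ih d κ ρ m hκ hm hρ hb
    refine ⟨_, _, .seq hx (.store _ _ _ _), ?_, ?_, wr _ _ _ hm', ?_⟩
    · simp only [Expr.cost, time]; omega
    · simp [Expr.eval, eval, wr2, hv, hm' a h]
    · intro j hj
      simp [Expr.eval, wr2, hj.ne, hlow j hj]
  | add x y ihx ihy =>
    intro d κ ρ m hκ hm hρ hb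
    obtain ⟨m₁, t₁, h₁, ht₁, hv₁, hm₁, hlow₁⟩ := ihx d κ ρ m hκ hm hρ hb.1
    obtain ⟨m₂, t₂, h₂, ht₂, hv₂, hm₂, hlow₂⟩ := ihy (d + 1) κ ρ m₁
      (fun i => (hκ i).trans d.lt_succ_self) hm₁ (fun i => by rw [hlow₁ _ (hκ i), hρ]) hb.2
    refine ⟨_, _, .seq h₁ (.seq h₂ (.store _ _ _ _)), ?_, ?_, wr _ _ _ hm₂, ?_⟩
    · simp only [Expr.cost, time]; omega
    · simp [Expr.eval, eval, wr2, hv₂, hlow₂ d d.lt_succ_self, hv₁]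
    · intro j hj
      simp [Expr.eval, wr2, hj.ne, hlow₂ j (hj.trans d.lt_succ_self), hlow₁ j hj]
  | sub x y ihx ihy =>
    intro d κ ρ m hκ hm hρ hb
    obtain ⟨m₁, t₁, h₁, ht₁, hv₁, hm₁, hlow₁⟩ := ihx d κ ρ m hκ hm hρ hb.1
    obtain ⟨m₂, t₂, h₂, ht₂, hv₂, hm₂, hlow₂⟩ := ihy (d + 1) κ ρ m₁
      (fun i => (hκ i).trans d.lt_succ_self) hm₁ (fun i => by rw [hlow₁ _ (hκ i), hρ]) hb.2
    refine ⟨_, _, .seq h₁ (.seq h₂ (.store _ _ _ _)), ?_, ?_, wr _ _ _ hm₂, ?_⟩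
    · simp only [Expr.cost, time]; omega
    · simp [Expr.eval, eval, wr2, hv₂, hlow₂ d d.lt_succ_self, hv₁]
    · intro j hj
      simp [Expr.eval, wr2, hj.ne, hlow₂ j (hj.trans d.lt_succ_self), hlow₁ j hj]
  | ite x y z ihx ihy ihz =>
    intro d κ ρ m hκ hm hρ hb
    obtain ⟨m₁, t₁, h₁, ht₁, hv₁, hm₁, hlow₁⟩ := ihx d κ ρ m hκ hm hρ hb.1
    have hρ₁ : ∀ i, m₁ 2 (κ i) = ρ i := fun i => by rw [hlow₁ _ (hκ i), hρ]
    by_cases hc : x.eval m₀ ρ = 0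
    · obtain ⟨m₂, t₂, h₂, ht₂, hv₂, hm₂, hlow₂⟩ := ihz d κ ρ m₁ hκ hm₁ hρ₁ hb.2.2
      refine ⟨_, _, .seq h₁ (.cond_false ?_ h₂), ?_, ?_, hm₂, ?_⟩
      · simpa [Expr.eval, hv₁] using hc
      · simp only [Expr.cost, time]; omega
      · simp [eval, hc, hv₂]
      · intro j hj
        rw [hlow₂ j hj, hlow₁ j hj]
    · obtain ⟨m₂, t₂, h₂, ht₂, hv₂, hm₂, hlow₂⟩ := ihy d κ ρ m₁ hκ hm₁ hρ₁ hb.2.1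
      refine ⟨_, _, .seq h₁ (.cond_true ?_ h₂), ?_, ?_, hm₂, ?_⟩
      · simpa [Expr.eval, hv₁] using hc
      · simp only [Expr.cost, time]; omega
      · simp [eval, hc, hv₂]
      · intro j hj
        rw [hlow₂ j hj, hlow₁ j hj]
  | ren g x ih =>
    intro d κ ρ m hκ hm hρ hb
    exact ih d _ _ m (fun i => hκ _) hm (fun i => hρ _) hb
  | fold n z s ihn ihz ihs =>
    intro d κ ρ m hκ hm hρ hb
    obtain ⟨hbn, hbz, hV, hbs⟩ := hb
    obtain ⟨m₁, t₁, h₁, ht₁, hv₁, hm₁, hlow₁⟩ := ihz d κ ρ m hκ hm hρ hbz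
    obtain ⟨m₂, t₂, h₂, ht₂, hv₂, hm₂, hlow₂⟩ := ihn (d + 1) κ ρ m₁
      (fun i => (hκ i).trans d.lt_succ_self) hm₁ (fun i => by rw [hlow₁ _ (hκ i), hρ]) hbn
    -- the loop, entered with `r` iterations to go
    have key : ∀ (r j : ℕ) (m₃ : Memory), j + r = n.eval m₀ ρ → (∀ a, a ≠ 2 → m₃ a = m₀ a) →
        (∀ i < d, m₃ 2 i = m 2 i) → m₃ 2 d = iter m₀ z s ρ j → m₃ 2 (d + 1) = n.eval m₀ ρ →
        m₃ 2 (d + 2) = j →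
        ∃ (m' : Memory) (t : ℕ), Exec ω (.loop (.sub (tmp (d + 1)) (tmp (d + 2)))
          (.seq (s.compile (d + 3) (loopCells d κ))
            (.seq (.store 2 (.const d) (tmp (d + 3)))
              (.store 2 (.const (d + 2)) (.add (tmp (d + 2)) (.const 1))))))
          ⟨m₃, pos⟩ ⟨m', pos⟩ t ∧ t ≤ r * (s.time V + 16) + 6 ∧
          m' 2 d = iter m₀ z s ρ (n.eval m₀ ρ) ∧ (∀ a, a ≠ 2 → m' a = m₀ a) ∧
          ∀ i < d, m' 2 i = m 2 i := by
      intro r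
      induction r with
      | zero =>
        intro j m₃ hj hm₃ hlow hacc hbd hct
        refine ⟨m₃, _, .loop_false ?_, ?_, ?_, hm₃, hlow⟩
        · simp [Expr.eval, hbd, hct]; omega
        · simp [Expr.cost]
        · rw [hacc, ← hj, add_zero]
      | succ r ihr =>
        intro j m₃ hj hm₃ hlow hacc hbd hct
        have hjn : j < n.eval m₀ ρ := by omega
        obtain ⟨m₄, t₄, h₄, ht₄, hv₄, hm₄, hlow₄⟩ := ihs (d + 3) (loopCells d κ)
          (push (iter m₀ z s ρ j) (push j ρ)) m₃
          (by
            intro i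
            match i with
            | 0 => simp [loopCells]
            | 1 => simp [loopCells]
            | i + 2 => simpa [loopCells] using (hκ i).trans (by omega))
          hm₃
          (by
            intro i
            match i with
            | 0 => simpa [loopCells] using hacc
            | 1 => simpa [loopCells] using hct
            | i + 2 => simpa [loopCells] using (hlow _ (hκ i)).trans (hρ i))
          (hbs j hjn)
        obtain ⟨m', t', h', ht', hv', hm', hlow'⟩ := ihr (j + 1)
          ((m₄.write 2 d (m₄ 2 (d + 3))).write 2 (d + 2)
            ((m₄.write 2 d (m₄ 2 (d + 3))) 2 (d + 2) + 1)) (by omega)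
          (wr _ _ _ (wr _ _ _ hm₄))
          (by
            intro i hi
            have h1 : i ≠ d + 2 := by omega
            have h2 : i ≠ d := by omega
            simp only [wr2, h1, h2, if_false]
            rw [hlow₄ i (by omega), hlow i hi])
          (by
            have h1 : d ≠ d + 2 := by omega
            simp only [wr2, h1, if_false, if_true]
            rw [hv₄]
            rfl)
          (by
            have h1 : d + 1 ≠ d + 2 := by omega
            have h2 : d + 1 ≠ d := by omega
            simp only [wr2, h1, h2, if_false]
            rw [hlow₄ _ (by omega), hbd])
          (by
            have h2 : d + 2 ≠ d := by omega
            simp only [wr2, h2, if_false, if_true]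
            rw [hlow₄ _ (by omega), hct])
        refine ⟨m', _, .loop_true ?_ (.seq h₄ (.seq (.store _ _ _ _) (.store _ _ _ _))) h',
          ?_, hv', hm', hlow'⟩
        · simp [Expr.eval, hbd, hct]; omega
        · simp only [Expr.cost]
          rw [Nat.succ_mul]
          omega
    obtain ⟨m', t', h', ht', hv', hm', hlow'⟩ := key (n.eval m₀ ρ) 0
      (m₂.write 2 (d + 2) 0) (by omega) (wr _ _ _ hm₂)
      (by
        intro i hi
        have h1 : i ≠ d + 2 := by omega
        simp only [wr2, h1, if_false]
        rw [hlow₂ i (by omega), hlow₁ i hi])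
      (by
        have h1 : d ≠ d + 2 := by omega
        simp only [wr2, h1, if_false]
        rw [hlow₂ d (by omega), hv₁]
        rfl)
      (by
        have h1 : d + 1 ≠ d + 2 := by omega
        simp only [wr2, h1, if_false]
        exact hv₂)
      (by simp [wr2])
    refine ⟨m', _, .seq h₁ (.seq h₂ (.seq (.store _ _ _ _) h')), ?_, hv', hm', hlow'⟩
    have : n.eval m₀ ρ * (s.time V + 16) ≤ V * (s.time V + 16) := Nat.mul_le_mul_right _ hV
    simp only [Expr.cost, time]
    omega

/-- Terms take polynomial time in the bound on the number of iterations. -/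
theorem time_le_poly (x : Tm) : ∃ C d : ℕ, ∀ V : ℕ, 1 ≤ V → x.time V ≤ C * V ^ d := by
  have up : ∀ {C d V : ℕ} (e : ℕ), 1 ≤ V → d ≤ e → C * V ^ d ≤ C * V ^ e :=
    fun e hV h => Nat.mul_le_mul_left _ (Nat.pow_le_pow_right hV h)
  have one : ∀ {V : ℕ} (e : ℕ), 1 ≤ V → 1 ≤ V ^ e := fun e hV => Nat.one_le_pow _ _ hV
  induction x with
  | var i => exact ⟨4, 0, fun V _ => by simp [time]⟩
  | const n => exact ⟨3, 0, fun V _ => by simp [time]⟩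
  | read a h x ih =>
    obtain ⟨C, d, hC⟩ := ih
    refine ⟨C + 5, d, fun V hV => ?_⟩
    have := hC V hV
    have := one d hV
    simp only [time, add_mul]; omega
  | add x y ihx ihy =>
    obtain ⟨C, d, hC⟩ := ihx
    obtain ⟨C', d', hC'⟩ := ihy
    refine ⟨C + C' + 7, d + d', fun V hV => ?_⟩
    have := (hC V hV).trans (up (d + d') hV (by omega))
    have := (hC' V hV).trans (up (d + d') hV (by omega))
    have := one (d + d') hV
    simp only [time, add_mul]; omega
  | sub x y ihx ihy =>
    obtain ⟨C, d, hC⟩ := ihx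
    obtain ⟨C', d', hC'⟩ := ihy
    refine ⟨C + C' + 7, d + d', fun V hV => ?_⟩
    have := (hC V hV).trans (up (d + d') hV (by omega))
    have := (hC' V hV).trans (up (d + d') hV (by omega))
    have := one (d + d') hV
    simp only [time, add_mul]; omega
  | ite x y z ihx ihy ihz =>
    obtain ⟨C, d, hC⟩ := ihx
    obtain ⟨C', d', hC'⟩ := ihy
    obtain ⟨C'', d'', hC''⟩ := ihz
    refine ⟨C + C' + C'' + 3, d + d' + d'', fun V hV => ?_⟩
    have := (hC V hV).trans (up (d + d' + d'') hV (by omega))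
    have := (hC' V hV).trans (up (d + d' + d'') hV (by omega))
    have := (hC'' V hV).trans (up (d + d' + d'') hV (by omega))
    have := one (d + d' + d'') hV
    simp only [time, add_mul]; omega
  | fold n z s ihn ihz ihs =>
    obtain ⟨C, d, hC⟩ := ihn
    obtain ⟨C', d', hC'⟩ := ihz
    obtain ⟨C'', d'', hC''⟩ := ihs
    refine ⟨C + C' + (C'' + 16) + 9, d + d' + d'' + 1, fun V hV => ?_⟩
    have := (hC V hV).trans (up (d + d' + d'' + 1) hV (by omega))
    have := (hC' V hV).trans (up (d + d' + d'' + 1) hV (by omega))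
    have h3 : V * (s.time V + 16) ≤ (C'' + 16) * V ^ (d + d' + d'' + 1) := by
      have h1 := (hC'' V hV).trans (up (d + d' + d'') hV (by omega))
      have h2 := one (d + d' + d'') hV
      calc V * (s.time V + 16) ≤ V * ((C'' + 16) * V ^ (d + d' + d'')) := by
            apply Nat.mul_le_mul_left
            rw [add_mul]; omega
        _ = _ := by ring
    have := one (d + d' + d'' + 1) hV
    simp only [time]
    rw [add_mul, add_mul, add_mul]; omega
  | ren g x ih => exact ih

end Tm

/-! ### Running a program on a block of arrays -/

/-- The expression with all arrays moved by `3`. -/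
def Expr.shift : Expr → Expr
  | .const n => .const n
  | .read a i => .read (a + 3) i.shift
  | .add x y => .add x.shift y.shift
  | .sub x y => .sub x.shift y.shift

/-- The program with all arrays moved by `3`. -/
def Cmd.shift : Cmd → Cmd
  | .skip => .skip
  | .store a i x => .store (a + 3) i.shift x.shift
  | .toss a i => .toss (a + 3) i.shift
  | .seq c d => .seq c.shift d.shift
  | .cond x c d => .cond x.shift c.shift d.shift
  | .loop x c => .loop x.shift c.shift

theorem Expr.cost_shift (x : Expr) : x.shift.cost = x.cost := by
  induction x <;> simp_all [shift, cost]

theorem Expr.eval_shift {m m₁ : Memory} (h : ∀ a, m₁ (a + 3) = m a) (x : Expr) :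
    x.shift.eval m₁ = x.eval m := by
  induction x <;> simp_all [shift, eval]

/-- The memory that has `m` in the arrays from `3` on, and the arrays `0`, `1`, `2` of `m₀`. -/
def Memory.above (m₀ m : Memory) : Memory
  | 0 => m₀ 0
  | 1 => m₀ 1
  | 2 => m₀ 2
  | a + 3 => m a

theorem Memory.above_write (m₀ m : Memory) (a i v : ℕ) :
    (m₀.above m).write (a + 3) i v = m₀.above (m.write a i v) := by
  funext b j
  match b with
  | 0 => simp [Memory.write, Memory.above]
  | 1 => simp [Memory.write, Memory.above]
  | 2 => simp [Memory.write, Memory.above]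
  | b + 3 => simp [Memory.write, Memory.above]

theorem Exec.shift (m₀ : Memory) {ω : Coins} {c : Cmd} {s s' : State} {t : ℕ}
    (h : Exec ω c s s' t) :
    Exec ω c.shift ⟨m₀.above s.mem, s.pos⟩ ⟨m₀.above s'.mem, s'.pos⟩ t := by
  have ev : ∀ (m : Memory) (x : Expr), x.shift.eval (m₀.above m) = x.eval m :=
    fun m x => Expr.eval_shift (fun _ => rfl) x
  induction h with
  | skip s => exact .skip _
  | store a i x s =>
    have := Exec.store (ω := ω) (a + 3) i.shift x.shift ⟨m₀.above s.mem, s.pos⟩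
    simp only [ev, Expr.cost_shift, Memory.above_write] at this
    exact this
  | toss a i s =>
    have := Exec.toss (ω := ω) (a + 3) i.shift ⟨m₀.above s.mem, s.pos⟩
    simp only [ev, Expr.cost_shift, Memory.above_write] at this
    exact this
  | seq _ _ ih ih' => exact .seq ih ih'
  | @cond_true x c d _ _ _ hx _ ih =>
    have := Exec.cond_true (x := x.shift) (d := d.shift) (by simpa only [ev] using hx) ih
    simp only [Expr.cost_shift] at this
    exact this
  | @cond_false x c d _ _ _ hx _ ih =>
    have := Exec.cond_false (x := x.shift) (c := c.shift) (by simpa only [ev] using hx) ih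
    simp only [Expr.cost_shift] at this
    exact this
  | @loop_true x c _ _ _ _ _ hx _ _ ih ih' =>
    have := Exec.loop_true (x := x.shift) (by simpa only [ev] using hx) ih ih'
    simp only [Expr.cost_shift] at this
    exact this
  | @loop_false x c s hx =>
    have := Exec.loop_false (ω := ω) (x := x.shift) (c := c.shift)
      (s := ⟨m₀.above s.mem, s.pos⟩) (by simpa only [ev] using hx)
    simp only [Expr.cost_shift] at this
    exact this

end RAM

/-! ### A family of tight instances -/

namespace CapSoR

/-- The centers whose cluster has a point at distance exactly `2`. -/
def Solution.far {I : CapSoR} (x : I.Solution) : Finset (Fin I.n) :=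
  Finset.univ.filter fun s => ∃ p, x.σ p = s ∧ I.dist p s = 2

theorem Solution.mem_cluster {I : CapSoR} {x : I.Solution} {p s : Fin I.n} :
    p ∈ x.cluster s ↔ x.σ p = s := by
  simp [Solution.cluster]

theorem Solution.sum_card_cluster {I : CapSoR} (x : I.Solution) (T : Finset (Fin I.n)) :
    ∑ s ∈ T, (x.cluster s).card = (Finset.univ.filter fun p => x.σ p ∈ T).card := by
  rw [Finset.card_eq_sum_card_fiberwise (t := T) (f := x.σ) (by intro p hp; simpa using hp)]
  refine Finset.sum_congr rfl fun s hs => ?_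
  congr 1
  ext p
  simp only [Solution.cluster, Finset.mem_filter, Finset.mem_univ, true_and]
  constructor
  · rintro rfl
    exact ⟨hs, rfl⟩
  · exact fun h => h.2

theorem Solution.Feasible.card_preimage_le {I : CapSoR} {x : I.Solution} (hx : x.Feasible)
    {T : Finset (Fin I.n)} (hT : T ⊆ x.S) :
    (Finset.univ.filter fun p => x.σ p ∈ T).card ≤ T.card * I.U := by
  rw [← x.sum_card_cluster, ← smul_eq_mul]
  exact Finset.sum_le_card_nsmul _ _ _ fun s hs => hx.2.2 s (hT hs)

theorem Solution.Feasible.far_subset {I : CapSoR} {x : I.Solution} (hx : x.Feasible) :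
    x.far ⊆ x.S := by
  intro s hs
  obtain ⟨p, rfl, -⟩ := (Finset.mem_filter.1 hs).2
  exact hx.1 p

/-- If the capacities add up to the number of points, then every cluster is full. -/
theorem Solution.Feasible.tight {I : CapSoR} {x : I.Solution} (hx : x.Feasible)
    (hn : I.n = I.k * I.U) :
    x.S.card = I.k ∧ ∀ s ∈ x.S, (x.cluster s).card = I.U := by
  have hU : 0 < I.U := Nat.pos_of_ne_zero fun h => by
    have := I.n_pos; rw [hn, h] at this; simp at this
  have hsum : ∑ s ∈ x.S, (x.cluster s).card = I.n := by
    rw [x.sum_card_cluster, Finset.filter_true_of_mem fun p _ => hx.1 p]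
    simp
  have hle : ∑ s ∈ x.S, (x.cluster s).card ≤ x.S.card * I.U := by
    rw [← smul_eq_mul]
    exact Finset.sum_le_card_nsmul _ _ _ hx.2.2
  have hcard : x.S.card = I.k := by
    refine le_antisymm hx.2.1 (Nat.le_of_mul_le_mul_right ?_ hU)
    omega
  refine ⟨hcard, ?_⟩
  refine (Finset.sum_eq_sum_iff_of_le hx.2.2).1 ?_
  rw [hsum, Finset.sum_const, smul_eq_mul, hcard, hn]

/-- In an instance with tight capacities, every cluster has radius at least `1`. -/
theorem Solution.Feasible.le_cost {I : CapSoR} {x : I.Solution} (hx : x.Feasible)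
    (hn : I.n = I.k * I.U) (hU : 2 ≤ I.U) : I.k + x.far.card ≤ x.cost := by
  obtain ⟨hS, hc⟩ := hx.tight hn
  have h1 : x.far.card = ∑ s ∈ x.S, if s ∈ x.far then 1 else 0 := by
    rw [Finset.sum_ite_mem, Finset.inter_eq_right.2 hx.far_subset]
    simp
  rw [← hS, h1, Finset.card_eq_sum_ones, ← Finset.sum_add_distrib]
  refine Finset.sum_le_sum fun s hs => ?_
  have hmem : ∀ p, x.σ p = s → I.dist p s ≤ x.rad s := fun p hp =>
    Finset.le_sup (f := fun p => I.dist p s) (mem_cluster.2 hp)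
  split_ifs with hf
  · obtain ⟨p, hp, hd⟩ := (Finset.mem_filter.1 hf).2
    have := hmem p hp
    omega
  · have hc2 : 1 < (x.cluster s).card := by rw [hc s hs]; omega
    obtain ⟨p, hp, hps⟩ := Finset.exists_mem_ne hc2 s
    have h2 := hmem p (mem_cluster.1 hp)
    have h3 : I.dist p s ≠ 0 := fun h => hps ((I.dist_eq_zero p s).1 h)
    omega

end CapSoR

/-- The sizes of a gap instance: `K` rows, each with `L` candidate centers, `W * D` private points
and `W * D` copies of elements; element `c < K * D` has `W` copies. -/
structure Sizes where
  K : ℕ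
  L : ℕ
  D : ℕ
  W : ℕ

namespace Sizes

variable (z : Sizes)

/-- The length of a row, which is also the capacity. -/
def U : ℕ := z.L + z.W * z.D + z.W * z.D

/-- The element of which the point `p` in the last part of its row is a copy. -/
def elem (p : ℕ) : ℕ := p / z.U * z.D + (p % z.U - (z.L + z.W * z.D)) / z.W

/-- `p` is a candidate center, and `q` is adjacent to it: a candidate center or a private point of
the same row, or a copy of an element that `p` covers. -/
def Covers (cov : ℕ → ℕ → ℕ → Prop) (p q : ℕ) : Prop :=
  p % z.U < z.L ∧ ((p / z.U = q / z.U ∧ q % z.U < z.L + z.W * z.D) ∨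
    (z.L + z.W * z.D ≤ q % z.U ∧ cov (p / z.U) (p % z.U) (z.elem q)))

open Classical in
/-- The distance: `1` between adjacent points and `2` between all others. -/
noncomputable def dist (cov : ℕ → ℕ → ℕ → Prop) (p q : ℕ) : ℕ :=
  if p = q then 0 else if z.Covers cov p q ∨ z.Covers cov q p then 1 else 2

/-- All sizes are positive, and a row is longer than the number of candidate centers. -/
structure Good : Prop where
  K_pos : 0 < z.K
  L_pos : 0 < z.L
  D_pos : 0 < z.D
  le_W : z.K * z.L ≤ z.W

variable {z}

theorem Good.W_pos (h : z.Good) : 0 < z.W := (Nat.mul_pos h.K_pos h.L_pos).trans_le h.le_W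

theorem Good.U_pos (h : z.Good) : 0 < z.U := by
  have := h.L_pos
  unfold U
  omega

theorem Good.lt_U (h : z.Good) : z.K * z.L + 2 ≤ z.U := by
  have h1 := h.L_pos
  have h2 : z.W ≤ z.W * z.D := Nat.le_mul_of_pos_right _ h.D_pos
  have h3 := h.le_W
  have h4 := h.W_pos
  have h5 := Nat.mul_pos h.K_pos h.L_pos
  unfold U
  omega

/-- The instance of uniform capacitated sum of radii with the given sizes and cover relation. -/
noncomputable def Good.inst (h : z.Good) (cov : ℕ → ℕ → ℕ → Prop) : CapSoR where
  n := z.K * z.U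
  k := z.K
  U := z.U
  dist p q := z.dist cov p q
  n_pos := Nat.mul_pos h.K_pos h.U_pos
  k_pos := h.K_pos
  dist_eq_zero p q := by
    unfold dist
    split_ifs with h1 h2
    · simp [Fin.ext h1]
    · simpa [Fin.ext_iff] using h1
    · simpa [Fin.ext_iff] using h1
  dist_comm p q := by
    classical
    exact if_congr eq_comm rfl (if_congr or_comm rfl rfl)
  dist_triangle p q r := by
    unfold dist
    split_ifs <;> first | omega | simp_all

variable (h : z.Good) (cov : ℕ → ℕ → ℕ → Prop)

theorem dist_le_two (p q : ℕ) : z.dist cov p q ≤ 2 := by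
  unfold dist
  split_ifs <;> omega

theorem covers_of_dist_ne_two {cov : ℕ → ℕ → ℕ → Prop} {p q : ℕ} (hpq : p ≠ q)
    (hd : z.dist cov p q ≠ 2) : z.Covers cov p q ∨ z.Covers cov q p := by
  by_contra hc
  exact hd (by simp [dist, hpq, hc])

/-- The point with offset `r` in row `i`. -/
def pt (z : Sizes) (i r : ℕ) : ℕ := i * z.U + r

/-- Copy `w` of the element `c`. -/
def copy (z : Sizes) (c w : ℕ) : ℕ :=
  z.pt (c / z.D) (z.L + z.W * z.D + (c % z.D * z.W + w))

theorem pt_lt {i r : ℕ} (hi : i < z.K) (hr : r < z.U) : z.pt i r < z.K * z.U :=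
  calc i * z.U + r < (i + 1) * z.U := by rw [add_mul]; omega
    _ ≤ z.K * z.U := Nat.mul_le_mul_right _ hi

theorem pt_div {i r : ℕ} (hr : r < z.U) : z.pt i r / z.U = i := by
  rw [pt, mul_comm, Nat.mul_add_div (by omega), Nat.div_eq_of_lt hr, add_zero]

theorem pt_mod {i r : ℕ} (hr : r < z.U) : z.pt i r % z.U = r := by
  rw [pt, mul_comm, Nat.mul_add_mod, Nat.mod_eq_of_lt hr]

theorem pt_div_mod (p : ℕ) : z.pt (p / z.U) (p % z.U) = p := by
  rw [pt, mul_comm, Nat.div_add_mod]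

theorem copy_offset_lt (hD : 0 < z.D) {c w : ℕ} (hw : w < z.W) :
    z.L + z.W * z.D + (c % z.D * z.W + w) < z.U := by
  have : (c % z.D + 1) * z.W ≤ z.D * z.W := Nat.mul_le_mul_right _ (Nat.mod_lt c hD)
  rw [add_mul, mul_comm z.D] at this
  unfold U
  omega

theorem copy_mod (hD : 0 < z.D) {c w : ℕ} (hw : w < z.W) :
    z.copy c w % z.U = z.L + z.W * z.D + (c % z.D * z.W + w) :=
  pt_mod (copy_offset_lt hD hw)

theorem elem_copy (hD : 0 < z.D) {c w : ℕ} (hw : w < z.W) : z.elem (z.copy c w) = c := by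
  rw [elem, copy_mod hD hw, copy, pt_div (copy_offset_lt hD hw), Nat.add_sub_cancel_left,
    mul_comm (c % z.D), Nat.mul_add_div (by omega), Nat.div_eq_of_lt hw, add_zero, mul_comm,
    Nat.div_add_mod]

theorem copy_lt (hD : 0 < z.D) {c w : ℕ} (hc : c < z.K * z.D) (hw : w < z.W) :
    z.copy c w < z.K * z.U :=
  pt_lt ((Nat.div_lt_iff_lt_mul hD).2 hc) (copy_offset_lt hD hw)

theorem elem_lt_and_copy_elem (h : z.Good) {p : ℕ} (hp : p < z.K * z.U)
    (hoff : z.L + z.W * z.D ≤ p % z.U) :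
    z.elem p < z.K * z.D ∧ ∃ w < z.W, z.copy (z.elem p) w = p := by
  have hi : p / z.U < z.K := (Nat.div_lt_iff_lt_mul h.U_pos).2 hp
  have hr := Nat.mod_lt p h.U_pos
  have ht : (p % z.U - (z.L + z.W * z.D)) / z.W < z.D := by
    rw [Nat.div_lt_iff_lt_mul h.W_pos, mul_comm z.D]
    have : z.U = z.L + z.W * z.D + z.W * z.D := rfl
    omega
  refine ⟨?_, (p % z.U - (z.L + z.W * z.D)) % z.W, Nat.mod_lt _ h.W_pos, ?_⟩
  · calc z.elem p < (p / z.U + 1) * z.D := by rw [elem, add_mul]; omega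
      _ ≤ _ := Nat.mul_le_mul_right _ hi
  · have h1 : z.elem p / z.D = p / z.U := by
      rw [elem, mul_comm, Nat.mul_add_div h.D_pos, Nat.div_eq_of_lt ht, add_zero]
    have h2 : z.elem p % z.D = (p % z.U - (z.L + z.W * z.D)) / z.W := by
      rw [elem, mul_comm, Nat.mul_add_mod, Nat.mod_eq_of_lt ht]
    rw [copy, h1, h2, mul_comm _ z.W, Nat.div_add_mod, Nat.add_sub_cancel' hoff, pt_div_mod]

/-! ### Solutions of cost `K` -/

section Complete

variable {A g : ℕ → ℕ}

/-- The row to whose center the point `p` is assigned, when the element `c` goes to row `g c`. -/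
def target (z : Sizes) (g : ℕ → ℕ) (p : ℕ) : ℕ :=
  if p % z.U < z.L + z.W * z.D then p / z.U else g (z.elem p)

theorem target_lt (h : z.Good) (hg : ∀ c < z.K * z.D, g c < z.K) {p : ℕ} (hp : p < z.K * z.U) :
    z.target g p < z.K := by
  unfold target
  split_ifs with hc
  · exact (Nat.div_lt_iff_lt_mul h.U_pos).2 hp
  · exact hg _ (elem_lt_and_copy_elem h hp (not_lt.1 hc)).1

theorem center_lt_U (hA : ∀ i, A i < z.L) (i : ℕ) : A i < z.U :=
  (hA i).trans_le (by unfold U; omega)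

theorem card_target_le (h : z.Good)
    (hgD : ∀ i < z.K, ((Finset.range (z.K * z.D)).filter fun c => g c = i).card ≤ z.D) {i : ℕ}
    (hi : i < z.K) :
    ((Finset.range (z.K * z.U)).filter fun p => z.target g p = i).card ≤ z.U := by
  have hsub : ((Finset.range (z.K * z.U)).filter fun p => z.target g p = i) ⊆
      (Finset.range (z.L + z.W * z.D)).image (z.pt i) ∪
        (((Finset.range (z.K * z.D)).filter fun c => g c = i) ×ˢ Finset.range z.W).image
          fun cw => z.copy cw.1 cw.2 := by
    intro p hp
    obtain ⟨hp, ht⟩ := Finset.mem_filter.1 hp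
    rw [Finset.mem_range] at hp
    unfold target at ht
    split_ifs at ht with hc
    · refine Finset.mem_union_left _ (Finset.mem_image.2 ⟨p % z.U, Finset.mem_range.2 hc, ?_⟩)
      rw [← ht, pt_div_mod]
    · obtain ⟨he, w, hw, hcopy⟩ := elem_lt_and_copy_elem h hp (not_lt.1 hc)
      refine Finset.mem_union_right _ (Finset.mem_image.2 ⟨(z.elem p, w), ?_, hcopy⟩)
      simp [he, hw, ht]
  refine (Finset.card_le_card hsub).trans ((Finset.card_union_le _ _).trans ?_)
  have h1 := Finset.card_image_le (s := Finset.range (z.L + z.W * z.D)) (f := z.pt i)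
  have h2 := Finset.card_image_le
    (s := ((Finset.range (z.K * z.D)).filter fun c => g c = i) ×ˢ Finset.range z.W)
    (f := fun cw => z.copy cw.1 cw.2)
  rw [Finset.card_range] at h1
  rw [Finset.card_product, Finset.card_range] at h2
  have h3 := Nat.mul_le_mul_right z.W (hgD i hi)
  rw [mul_comm z.D] at h3
  unfold U
  omega

/-- The solution that has the center with offset `A i` in row `i`, and assigns the element `c` to
the center in row `g c`. -/
noncomputable def Good.solution (h : z.Good) (hA : ∀ i, A i < z.L)
    (hg : ∀ c < z.K * z.D, g c < z.K) : (h.inst cov).Solution where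
  S := (Finset.univ : Finset (Fin z.K)).image fun i : Fin z.K =>
    (⟨z.pt i (A i), pt_lt i.2 (center_lt_U hA i)⟩ : Fin (z.K * z.U))
  σ p := ⟨z.pt (z.target g p) (A (z.target g p)),
    pt_lt (target_lt h hg p.2) (center_lt_U hA _)⟩

theorem Good.solution_feasible (hA : ∀ i, A i < z.L) (hg : ∀ c < z.K * z.D, g c < z.K)
    (hgD : ∀ i < z.K, ((Finset.range (z.K * z.D)).filter fun c => g c = i).card ≤ z.D) :
    (h.solution cov hA hg).Feasible := by
  refine ⟨fun p => ?_, ?_, ?_⟩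
  · exact Finset.mem_image.2 ⟨⟨z.target g p, target_lt h hg p.2⟩, Finset.mem_univ _, rfl⟩
  · refine Finset.card_image_le.trans ?_
    simp [Good.inst]
  · intro s hs
    obtain ⟨i, -, rfl⟩ := Finset.mem_image.1 hs
    refine le_trans ?_ (card_target_le h hgD i.2)
    refine Finset.card_le_card_of_injOn (fun p => (p : ℕ)) ?_ (fun p _ q _ hpq => Fin.ext hpq)
    intro p hp
    have hp : z.pt (z.target g p) (A (z.target g p)) = z.pt i (A i) := by
      exact congrArg Fin.val (CapSoR.Solution.mem_cluster.1 hp)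
    have := congrArg (· / z.U) hp
    simp only [pt_div (center_lt_U hA _)] at this
    exact Finset.mem_filter.2 ⟨Finset.mem_range.2 p.2, this⟩

theorem Good.cost_solution_le (hA : ∀ i, A i < z.L) (hg : ∀ c < z.K * z.D, g c < z.K)
    (hcov : ∀ c < z.K * z.D, cov (g c) (A (g c)) c) :
    (h.solution cov hA hg).cost ≤ z.K := by
  have hrad : ∀ s ∈ (h.solution cov hA hg).S, (h.solution cov hA hg).rad s ≤ 1 := by
    intro s _
    refine Finset.sup_le fun p hp => ?_
    have hp : (h.solution cov hA hg).σ p = s :=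
      CapSoR.Solution.mem_cluster.1 hp
    subst hp
    change z.dist cov p (z.pt (z.target g p) (A (z.target g p))) ≤ 1
    have hc : z.Covers cov (z.pt (z.target g p) (A (z.target g p))) p := by
      unfold Covers
      rw [pt_div (center_lt_U hA _), pt_mod (center_lt_U hA _)]
      refine ⟨hA _, ?_⟩
      unfold target
      split_ifs with ho
      · exact .inl ⟨rfl, ho⟩
      · exact .inr ⟨not_lt.1 ho, hcov _ (elem_lt_and_copy_elem h p.2 (not_lt.1 ho)).1⟩
    unfold dist
    split_ifs with h1 h2
    · omega
    · omega
    · exact absurd (.inr hc) h2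
  refine (Finset.sum_le_card_nsmul _ _ _ hrad).trans ?_
  rw [smul_eq_mul, mul_one]
  refine Finset.card_image_le.trans ?_
  simp

theorem Good.exists_feasible : ∃ y : (h.inst cov).Solution, y.Feasible := by
  have hlt : ∀ c < z.K * z.D, c / z.D < z.K := fun c hc => (Nat.div_lt_iff_lt_mul h.D_pos).2 hc
  refine ⟨_, h.solution_feasible (A := fun _ => 0) (g := fun c => c / z.D) cov
    (fun _ => h.L_pos) hlt fun i _ => ?_⟩
  calc _ ≤ ((Finset.range z.D).image fun t => i * z.D + t).card := by
        refine Finset.card_le_card fun c hc => ?_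
        obtain ⟨-, hc⟩ := Finset.mem_filter.1 hc
        refine Finset.mem_image.2 ⟨c % z.D, Finset.mem_range.2 (Nat.mod_lt _ h.D_pos), ?_⟩
        rw [← hc, mul_comm, Nat.div_add_mod]
    _ ≤ _ := Finset.card_image_le.trans (by simp)

end Complete

/-! ### Solutions with few clusters of radius `2` -/

section Sound

variable {h : z.Good} {cov : ℕ → ℕ → ℕ → Prop} {x : (h.inst cov).Solution}

theorem dist_ne_two_of_not_far {p : Fin (h.inst cov).n} (hp : x.σ p ∉ x.far) :
    z.dist cov p (x.σ p) ≠ 2 := fun hd =>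
  hp (Finset.mem_filter.2 ⟨Finset.mem_univ _, p, rfl, hd⟩)

/-- A point that is not a candidate center but belongs to a cluster of radius `1` around one is
covered by it. -/
theorem covers_of_not_far {p : Fin (h.inst cov).n} (hp : x.σ p ∉ x.far)
    (hs : (x.σ p : ℕ) % z.U < z.L) (hpL : z.L ≤ (p : ℕ) % z.U) : z.Covers cov (x.σ p) p := by
  have hne : (p : ℕ) ≠ x.σ p := fun heq => by rw [← heq] at hs; omega
  rcases covers_of_dist_ne_two hne (dist_ne_two_of_not_far hp) with hc | hc
  · exact absurd hc.1 (by omega)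
  · exact hc

/-- The clusters of radius `1` are large, and only the candidate centers have enough neighbors. -/
theorem isCandidate_of_not_far (hx : x.Feasible) {s : Fin (h.inst cov).n} (hs : s ∈ x.S)
    (hf : s ∉ x.far) : (s : ℕ) % z.U < z.L := by
  by_contra hL
  have hcard := (hx.tight rfl).2 s hs
  have hsub : (x.cluster s).image (fun p : Fin (h.inst cov).n => (p : ℕ)) ⊆
      insert (s : ℕ) ((Finset.range z.K ×ˢ Finset.range z.L).image fun ir => z.pt ir.1 ir.2) := by
    intro q hq
    obtain ⟨p, hp, rfl⟩ := Finset.mem_image.1 hq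
    have hp : x.σ p = s := CapSoR.Solution.mem_cluster.1 hp
    subst hp
    by_cases hps : (p : ℕ) = x.σ p
    · exact Finset.mem_insert.2 (.inl hps)
    · refine Finset.mem_insert_of_mem (Finset.mem_image.2 ⟨(p / z.U, p % z.U), ?_, pt_div_mod _⟩)
      rcases covers_of_dist_ne_two hps (dist_ne_two_of_not_far hf) with hc | hc
      · simpa using ⟨(Nat.div_lt_iff_lt_mul h.U_pos).2 p.2, hc.1⟩
      · exact absurd hc.1 hL
  have h1 := Finset.card_le_card hsub
  rw [Finset.card_image_of_injective _ Fin.val_injective, hcard] at h1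
  have h2 := Finset.card_insert_le (s : ℕ)
    ((Finset.range z.K ×ˢ Finset.range z.L).image fun ir => z.pt ir.1 ir.2)
  have h3 := Finset.card_image_le (s := Finset.range z.K ×ˢ Finset.range z.L)
    (f := fun ir => z.pt ir.1 ir.2)
  rw [Finset.card_product, Finset.card_range, Finset.card_range] at h3
  have h4 := h.lt_U
  have h5 : (h.inst cov).U = z.U := rfl
  omega

/-- Points whose numbers are given by an injective family and whose centers lie in `T` are at most
`U` for each element of `T`. -/
theorem card_le_of_injOn (hx : x.Feasible) {T : Finset (Fin (h.inst cov).n)} (hT : T ⊆ x.S)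
    {ι : Type*} (s : Finset ι) (f : ι → ℕ) (hf : Set.InjOn f s)
    (hlt : ∀ j ∈ s, ∃ p : Fin (h.inst cov).n, (p : ℕ) = f j ∧ x.σ p ∈ T) :
    s.card ≤ T.card * z.U := by
  refine le_trans ?_ (hx.card_preimage_le hT)
  rw [← Finset.card_image_of_injOn hf, ← Finset.card_image_of_injective
    (Finset.univ.filter fun p => x.σ p ∈ T) Fin.val_injective]
  refine Finset.card_le_card fun q hq => ?_
  obtain ⟨j, hj, rfl⟩ := Finset.mem_image.1 hq
  obtain ⟨p, hp, hpT⟩ := hlt j hj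
  exact Finset.mem_image.2 ⟨p, Finset.mem_filter.2 ⟨Finset.mem_univ _, hpT⟩, hp⟩

theorem U_le (h : z.Good) : z.U ≤ 3 * (z.W * z.D) := by
  have h1 : z.L ≤ z.K * z.L := Nat.le_mul_of_pos_left _ h.K_pos
  have h2 := h.le_W
  have h3 : z.W ≤ z.W * z.D := Nat.le_mul_of_pos_right _ h.D_pos
  unfold U
  omega

open Classical in
/-- A solution with few clusters of radius `2` yields a choice of one candidate center in each row
that covers almost all elements. -/
theorem exists_cover (hx : x.Feasible) : ∃ A : ℕ → ℕ, (∀ i, A i < z.L) ∧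
    ((Finset.range (z.K * z.D)).filter fun c => ¬ ∃ i < z.K, cov i (A i) c).card ≤
      9 * x.far.card * z.D := by
  obtain ⟨hS, -⟩ := hx.tight rfl
  change x.S.card = z.K at hS
  have hWD : 0 < z.W * z.D := Nat.mul_pos h.W_pos h.D_pos
  -- the rows without a cluster of radius `1`; their private points lie in clusters of radius `2`
  let E := (Finset.range z.K).filter fun i => ¬ ∃ s ∈ x.S, s ∉ x.far ∧ (s : ℕ) / z.U = i
  have hE : E.card ≤ 3 * x.far.card := by
    have h1 := card_le_of_injOn hx hx.far_subset (E ×ˢ Finset.range (z.W * z.D))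
      (fun ir => z.pt ir.1 (z.L + ir.2))
      (by
        rintro ⟨i, r⟩ hi ⟨j, q⟩ hj he
        simp only [Finset.coe_product, Set.mem_prod, Finset.mem_coe, Finset.mem_range] at hi hj
        have hr : z.L + r < z.U := by unfold U; omega
        have hq : z.L + q < z.U := by unfold U; omega
        have e1 := congrArg (· / z.U) he
        have e2 := congrArg (· % z.U) he
        simp only [pt_div hr, pt_div hq, pt_mod hr, pt_mod hq] at e1 e2
        exact Prod.ext e1 (by simpa using e2))
      (by
        rintro ⟨i, r⟩ hir
        obtain ⟨hi, hr⟩ := Finset.mem_product.1 hir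
        obtain ⟨hiK, hiE⟩ := Finset.mem_filter.1 hi
        simp only [Finset.mem_range] at hiK hr
        have hrU : z.L + r < z.U := by unfold U; omega
        refine ⟨⟨z.pt i (z.L + r), pt_lt hiK hrU⟩, rfl, ?_⟩
        by_contra hf
        have hcand := isCandidate_of_not_far hx (hx.1 _) hf
        have hc := covers_of_not_far hf hcand (by simp only [pt_mod hrU]; omega)
        unfold Covers at hc
        simp only [pt_div hrU, pt_mod hrU] at hc
        rcases hc.2 with hc | hc
        · exact hiE ⟨_, hx.1 _, hf, hc.1⟩
        · omega)
    rw [Finset.card_product, Finset.card_range] at h1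
    have h2 := Nat.mul_le_mul_left x.far.card (U_le h)
    refine Nat.le_of_mul_le_mul_right (h1.trans (h2.trans (le_of_eq ?_))) hWD
    ring
  have hrep : ∀ i, ∃ s : Fin (h.inst cov).n, i < z.K → i ∉ E →
      s ∈ x.S ∧ s ∉ x.far ∧ (s : ℕ) / z.U = i := by
    intro i
    by_cases hi : i < z.K ∧ i ∉ E
    · have : ∃ s ∈ x.S, s ∉ x.far ∧ (s : ℕ) / z.U = i := by
        by_contra hc
        exact hi.2 (Finset.mem_filter.2 ⟨Finset.mem_range.2 hi.1, hc⟩)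
      obtain ⟨s, hs⟩ := this
      exact ⟨s, fun _ _ => hs⟩
    · exact ⟨⟨0, (h.inst cov).n_pos⟩, fun h1 h2 => absurd ⟨h1, h2⟩ hi⟩
  choose rep hrep using hrep
  -- the centers that do not represent a row are few
  let R := (Finset.range z.K \ E).image rep
  have hRS : R ⊆ x.S := by
    intro s hs
    obtain ⟨i, hi, rfl⟩ := Finset.mem_image.1 hs
    obtain ⟨hi, hiE⟩ := Finset.mem_sdiff.1 hi
    exact (hrep i (Finset.mem_range.1 hi) hiE).1
  have hR : R.card = z.K - E.card := by
    rw [Finset.card_image_of_injOn, Finset.card_sdiff_of_subset (Finset.filter_subset _ _),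
      Finset.card_range]
    intro i hi j hj hij
    simp only [Finset.coe_sdiff, Set.mem_sdiff, Finset.mem_coe, Finset.mem_range] at hi hj
    rw [← (hrep i hi.1 hi.2).2.2, hij, (hrep j hj.1 hj.2).2.2]
  have hEK : E.card ≤ z.K := (Finset.card_filter_le _ _).trans (by simp)
  have hbad : (x.S \ R).card ≤ 3 * x.far.card := by
    rw [Finset.card_sdiff_of_subset hRS, hS, hR]
    omega
  refine ⟨fun i => if i < z.K ∧ i ∉ E then (rep i : ℕ) % z.U else 0, fun i => ?_, ?_⟩
  · dsimp only
    split_ifs with hi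
    · have := hrep i hi.1 hi.2
      exact isCandidate_of_not_far hx this.1 this.2.1
    · exact h.L_pos
  · have h1 := card_le_of_injOn hx (T := x.S \ R) Finset.sdiff_subset
      (((Finset.range (z.K * z.D)).filter fun c => ¬ ∃ i < z.K,
        cov i (if i < z.K ∧ i ∉ E then (rep i : ℕ) % z.U else 0) c) ×ˢ Finset.range z.W)
      (fun cw => z.copy cw.1 cw.2)
      (by
        rintro ⟨c, w⟩ hc ⟨c', w'⟩ hc' he
        simp only [Finset.coe_product, Set.mem_prod, Finset.mem_coe, Finset.mem_range] at hc hc'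
        have e1 := congrArg z.elem he
        simp only [elem_copy h.D_pos hc.2, elem_copy h.D_pos hc'.2] at e1
        subst e1
        have e2 := congrArg (· % z.U) he
        simp only [copy_mod h.D_pos hc.2, copy_mod h.D_pos hc'.2] at e2
        exact Prod.ext rfl (by simpa using e2))
      (by
        rintro ⟨c, w⟩ hcw
        obtain ⟨hc, hw⟩ := Finset.mem_product.1 hcw
        obtain ⟨hcK, hc⟩ := Finset.mem_filter.1 hc
        simp only [Finset.mem_range] at hcK hw hc
        refine ⟨⟨z.copy c w, copy_lt h.D_pos hcK hw⟩, rfl, ?_⟩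
        refine Finset.mem_sdiff.2 ⟨hx.1 _, fun hsR => hc ?_⟩
        obtain ⟨i, hi, hir⟩ := Finset.mem_image.1 hsR
        obtain ⟨hiK, hiE⟩ := Finset.mem_sdiff.1 hi
        rw [Finset.mem_range] at hiK
        obtain ⟨hrS, hrf, hri⟩ := hrep i hiK hiE
        have hcand := isCandidate_of_not_far hx hrS hrf
        have hcov := covers_of_not_far (by rw [← hir]; exact hrf) (by rw [← hir]; exact hcand)
          (by simp only [copy_mod h.D_pos hw]; omega)
        rw [← hir] at hcov
        unfold Covers at hcov
        simp only [elem_copy h.D_pos hw, copy_mod h.D_pos hw, hri] at hcov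
        refine ⟨i, hiK, ?_⟩
        rw [if_pos ⟨hiK, hiE⟩]
        rcases hcov.2 with hcov | hcov
        · omega
        · exact hcov.2)
    rw [Finset.card_product, Finset.card_range] at h1
    have h2 := Nat.mul_le_mul hbad (U_le h)
    refine Nat.le_of_mul_le_mul_right (h1.trans (h2.trans (le_of_eq ?_))) h.W_pos
    ring

end Sound

end Sizes

/-! ### From formulas to cover relations -/

/-- A formula as a table of literal slots: clause `c` has the slots `3 * c`, `3 * c + 1` and
`3 * c + 2`; `var t` is the variable in slot `t` and `sgn t` its sign, `0` or `1`. -/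
structure SlotTable where
  M : ℕ
  var : ℕ → ℕ
  sgn : ℕ → ℕ

namespace SlotTable

variable (T : SlotTable) (k B : ℕ)

/-- The number of groups, at most one more than the number of clauses; it is positive even if there
are no clauses. -/
def K : ℕ := min k (T.M + 1)

/-- A bound on the number of clauses in a group. -/
def s : ℕ := T.M / T.K k + 1

/-- The sizes of the gap instance: the candidate centers of a row are the assignments of truth
values to the `3 * s` slots of a group.  The variables that a group owns occur in at most
`D = 3 * s * B` clauses, so that a row has room for all the elements that are assigned to it. -/
def sizes : Sizes where
  K := T.K k
  L := 2 ^ (3 * T.s k)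
  D := 3 * B * T.s k
  W := T.K k * 2 ^ (3 * T.s k)

/-- The last index `t < n` with `p t`, and `0` if there is none. -/
def lastIndex (p : ℕ → Prop) [DecidablePred p] (n : ℕ) : ℕ :=
  Nat.rec 0 (fun t v => if p t then t else v) n

theorem lastIndex_spec (p : ℕ → Prop) [DecidablePred p] {n t : ℕ} (ht : t < n) (hp : p t) :
    lastIndex p n < n ∧ p (lastIndex p n) := by
  induction n with
  | zero => omega
  | succ n ih =>
    change (if p n then n else lastIndex p n) < n + 1 ∧ p (if p n then n else lastIndex p n)
    split_ifs with hn
    · exact ⟨n.lt_succ_self, hn⟩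
    · have : t < n := by
        rcases Nat.lt_succ_iff_lt_or_eq.1 ht with h | h
        · exact h
        · exact absurd (h ▸ hp) hn
      exact ⟨(ih this).1.trans n.lt_succ_self, (ih this).2⟩

theorem lastIndex_le (p : ℕ → Prop) [DecidablePred p] (n : ℕ) : lastIndex p n ≤ n := by
  induction n with
  | zero => exact le_rfl
  | succ n ih =>
    change (if p n then n else lastIndex p n) ≤ n + 1
    split_ifs <;> omega

/-- The slot that owns the variable `v`: its last occurrence. -/
def owner (v : ℕ) : ℕ := lastIndex (fun t => T.var t = v) (3 * T.M)

/-- The group of a slot: the clauses are distributed cyclically. -/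
def group (t : ℕ) : ℕ := t / 3 % T.K k

/-- The position of a slot in its group. -/
def place (t : ℕ) : ℕ := 3 * (t / 3 / T.K k) + t % 3

/-- The candidate center of group `i` with number `a` covers the clause `c` if it satisfies a
literal of `c` whose variable is owned by a slot of the group; the bits of `a` are the truth values
of the slots.  Numbers `c` beyond the clauses are covered by everything. -/
def cov (i a c : ℕ) : Prop :=
  T.M ≤ c ∨ ∃ l < 3, T.group k (T.owner (T.var (3 * c + l))) = i ∧
    a / 2 ^ T.place k (T.owner (T.var (3 * c + l))) % 2 = T.sgn (3 * c + l)

/-- The variable `v` occurs in the clause `c`. -/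
def Occurs (v c : ℕ) : Prop := ∃ l < 3, T.var (3 * c + l) = v

/-- The assignment `α` satisfies the clause `c`. -/
def Sat (α : ℕ → Bool) (c : ℕ) : Prop := ∃ l < 3, (α (T.var (3 * c + l))).toNat = T.sgn (3 * c + l)

variable {T k B}

theorem K_pos (hk : 0 < k) : 0 < T.K k := by
  unfold K
  omega

theorem lt_K_mul_s (hk : 0 < k) : T.M < T.K k * T.s k := Nat.lt_mul_div_succ _ (K_pos hk)

theorem K_mul_s_le (k : ℕ) : T.K k * T.s k ≤ 2 * T.M + 1 := by
  have h1 : T.K k * (T.M / T.K k) ≤ T.M := Nat.mul_div_le _ _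
  have h2 : T.K k ≤ T.M + 1 := min_le_right _ _
  unfold s
  rw [mul_add]
  omega

theorem sizes_good (hk : 0 < k) (hB : 0 < B) : (T.sizes k B).Good where
  K_pos := K_pos hk
  L_pos := by simp [sizes]
  D_pos := by
    have : 0 < T.s k := Nat.succ_pos _
    simp only [sizes]
    positivity
  le_W := le_rfl

theorem M_le (hk : 0 < k) (hB : 0 < B) : T.M ≤ (T.sizes k B).K * (T.sizes k B).D := by
  refine (lt_K_mul_s (T := T) hk).le.trans (Nat.mul_le_mul_left _ ?_)
  exact Nat.le_mul_of_pos_left _ (by omega)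

theorem owner_spec {t : ℕ} (ht : t < 3 * T.M) :
    T.owner (T.var t) < 3 * T.M ∧ T.var (T.owner (T.var t)) = T.var t :=
  lastIndex_spec (fun t' => T.var t' = T.var t) ht rfl

theorem place_lt {t : ℕ} (ht : t < 3 * T.M) : T.place k t < 3 * T.s k := by
  have h1 : t / 3 / T.K k ≤ T.M / T.K k := Nat.div_le_div_right (by omega)
  unfold place s
  omega

/-- The slot at place `b` of group `i`. -/
def slotAt (T : SlotTable) (k i b : ℕ) : ℕ := 3 * (b / 3 * T.K k + i) + b % 3

theorem slotAt_group_place (t : ℕ) : T.slotAt k (T.group k t) (T.place k t) = t := by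
  have h1 : T.place k t / 3 = t / 3 / T.K k := by unfold place; omega
  have h2 : T.place k t % 3 = t % 3 := by unfold place; omega
  have h3 := Nat.div_add_mod (t / 3) (T.K k)
  rw [slotAt, h1, h2, group, mul_comm (t / 3 / T.K k), h3]
  omega

/-- There is a number with prescribed bits. -/
theorem exists_bits (n : ℕ) (f : ℕ → Bool) :
    ∃ a < 2 ^ n, ∀ b < n, a / 2 ^ b % 2 = (f b).toNat := by
  refine ⟨Nat.ofBits fun i : Fin n => f i, Nat.ofBits_lt_two_pow _, fun b hb => ?_⟩
  have := Nat.testBit_ofBits_lt (fun i : Fin n => f i) b hb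
  rw [Nat.testBit_eq_decide_div_mod_eq] at this
  dsimp only at this
  rw [← this]
  rcases Nat.mod_two_eq_zero_or_one (Nat.ofBits (fun i : Fin n => f i) / 2 ^ b) with h | h <;>
    simp [h]

/-- A distribution of `m` elements to `K` rows with at most `D` in each extends to any
`n ≤ K * D` elements. -/
theorem exists_extension {K D m n : ℕ} (hmn : m ≤ n) (hn : n ≤ K * D) (g₀ : ℕ → ℕ)
    (h₀ : ∀ c < m, g₀ c < K)
    (hD : ∀ i < K, ((Finset.range m).filter fun c => g₀ c = i).card ≤ D) :
    ∃ g : ℕ → ℕ, (∀ c < m, g c = g₀ c) ∧ (∀ c < n, g c < K) ∧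
      ∀ i < K, ((Finset.range n).filter fun c => g c = i).card ≤ D := by
  induction n, hmn using Nat.le_induction with
  | base => exact ⟨g₀, fun _ _ => rfl, h₀, hD⟩
  | succ n hmn ih =>
    obtain ⟨g, hg₀, hgK, hgD⟩ := ih (by omega)
    obtain ⟨i, hi, hlt⟩ : ∃ i < K, ((Finset.range n).filter fun c => g c = i).card < D := by
      by_contra! hc
      have h1 := Finset.card_eq_sum_card_fiberwise (s := Finset.range n) (t := Finset.range K)
        (f := g) (fun c hc => by simpa using hgK c (by simpa using hc))
      have h2 := Finset.card_nsmul_le_sum (Finset.range K)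
        (fun i => ((Finset.range n).filter fun c => g c = i).card) D
        (fun i hi => hc i (Finset.mem_range.1 hi))
      rw [← h1, Finset.card_range, Finset.card_range, smul_eq_mul] at h2
      omega
    have hne : ∀ c < n, Function.update g n i c = g c := fun c hc =>
      Function.update_of_ne (by omega) _ _
    refine ⟨Function.update g n i, fun c hc => ?_, fun c hc => ?_, fun j hj => ?_⟩
    · rw [hne c (by omega), hg₀ c hc]
    · rcases Nat.lt_succ_iff_lt_or_eq.1 hc with h | rfl
      · rw [hne c h]
        exact hgK c h
      · simpa using hi
    · have h1 : ((Finset.range n).filter fun c => Function.update g n i c = j) =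
          (Finset.range n).filter fun c => g c = j :=
        Finset.filter_congr fun c hc => by rw [hne c (Finset.mem_range.1 hc)]
      rw [Finset.range_add_one, Finset.filter_insert, h1, Function.update_self]
      split_ifs with hij
      · subst hij
        exact (Finset.card_insert_le _ _).trans hlt
      · exact hgD j hj

open Classical in
/-- A satisfying assignment yields a solution of cost at most `K`. -/
theorem exists_solution_of_sat (hk : 0 < k) (hB : 0 < B) {α : ℕ → Bool}
    (hα : ∀ c < T.M, T.Sat α c)
    (hocc : ∀ v, ((Finset.range T.M).filter (T.Occurs v)).card ≤ B) :
    ∃ y : ((sizes_good (T := T) hk hB).inst (T.cov k)).Solution, y.Feasible ∧ y.cost ≤ T.K k := by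
  choose A hA hbit using fun i => exists_bits (3 * T.s k) fun b => α (T.var (T.slotAt k i b))
  have hl : ∀ c, ∃ l, c < T.M → l < 3 ∧ (α (T.var (3 * c + l))).toNat = T.sgn (3 * c + l) := by
    intro c
    by_cases hc : c < T.M
    · obtain ⟨l, hl, h⟩ := hα c hc
      exact ⟨l, fun _ => ⟨hl, h⟩⟩
    · exact ⟨0, fun h => absurd h hc⟩
  choose l hl using hl
  obtain ⟨g, hg₀, hgK, hgD⟩ := exists_extension (K := (T.sizes k B).K) (D := (T.sizes k B).D)
    (M_le (T := T) hk hB) le_rfl (fun c => T.group k (T.owner (T.var (3 * c + l c))))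
    (fun c _ => Nat.mod_lt _ (K_pos hk))
    (by
      intro i _
      calc _ ≤ ((Finset.range (3 * T.s k)).biUnion fun b =>
            (Finset.range T.M).filter (T.Occurs (T.var (T.slotAt k i b)))).card := by
            refine Finset.card_le_card fun c hc => ?_
            obtain ⟨hc', hi⟩ := Finset.mem_filter.1 hc
            subst hi
            have hcM := Finset.mem_range.1 hc'
            obtain ⟨h1, h2⟩ := owner_spec (T := T) (t := 3 * c + l c) (by have := hl c hcM; omega)
            refine Finset.mem_biUnion.2
              ⟨T.place k (T.owner (T.var (3 * c + l c))), Finset.mem_range.2 (place_lt h1), ?_⟩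
            rw [Finset.mem_filter]
            refine ⟨hc', l c, (hl c hcM).1, ?_⟩
            rw [slotAt_group_place, h2]
        _ ≤ (Finset.range (3 * T.s k)).card * B := Finset.card_biUnion_le_card_mul _ _ _
            fun b _ => hocc _
        _ = (T.sizes k B).D := by
            rw [Finset.card_range]
            simp only [sizes]
            ring)
  refine ⟨_, (sizes_good hk hB).solution_feasible (T.cov k) hA hgK hgD,
    (sizes_good hk hB).cost_solution_le (T.cov k) hA hgK fun c _ => ?_⟩
  by_cases hc : c < T.M
  · refine .inr ⟨l c, (hl c hc).1, (hg₀ c hc).symm, ?_⟩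
    obtain ⟨h1, h2⟩ := owner_spec (T := T) (t := 3 * c + l c) (by have := hl c hc; omega)
    rw [hg₀ c hc, hbit _ _ (place_lt h1), slotAt_group_place, h2, (hl c hc).2]
  · exact .inl (not_lt.1 hc)

open Classical in
/-- A solution with few clusters of radius `2` yields an assignment that satisfies most clauses. -/
theorem exists_assignment (hk : 0 < k) (hB : 0 < B)
    (hsgn : ∀ t < 3 * T.M, T.sgn t ≤ 1)
    {x : ((sizes_good (T := T) hk hB).inst (T.cov k)).Solution} (hx : x.Feasible) :
    ∃ α : ℕ → Bool, ((Finset.range T.M).filter fun c => ¬ T.Sat α c).card ≤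
      9 * x.far.card * (3 * B * T.s k) := by
  obtain ⟨A, -, hA⟩ := Sizes.exists_cover hx
  refine ⟨fun v => decide (A (T.group k (T.owner v)) / 2 ^ T.place k (T.owner v) % 2 = 1),
    le_trans (Finset.card_le_card fun c hc => ?_) hA⟩
  obtain ⟨hc, hns⟩ := Finset.mem_filter.1 hc
  rw [Finset.mem_range] at hc
  refine Finset.mem_filter.2 ⟨Finset.mem_range.2 (hc.trans_le (M_le hk hB)), ?_⟩
  rintro ⟨i, -, hcov⟩
  rcases hcov with h | ⟨l, hl, hi, hbit⟩
  · omega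
  · refine hns ⟨l, hl, ?_⟩
    have := hsgn (3 * c + l) (by omega)
    dsimp only
    rw [hi, hbit]
    interval_cases T.sgn (3 * c + l) <;> simp

end SlotTable

namespace Formula

variable (φ : Formula)

/-- The slots of a formula, as they appear in its encoding. -/
def slots : SlotTable where
  M := φ.M
  var t := φ.encode.getD (2 + 2 * t) 0
  sgn t := φ.encode.getD (3 + 2 * t) 0

theorem encode_eq : φ.encode = [φ.N, φ.M] ++ List.ofFn fun u : Fin (φ.M * 6) =>
    ![((φ.clause u.divNat 0).1 : ℕ), (φ.clause u.divNat 0).2.toNat,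
      ((φ.clause u.divNat 1).1 : ℕ), (φ.clause u.divNat 1).2.toNat,
      ((φ.clause u.divNat 2).1 : ℕ), (φ.clause u.divNat 2).2.toNat] u.modNat := by
  rw [encode, List.ofFn_mul]
  congr 3
  funext j
  have h1 : ∀ i : Fin 6, (⟨j * 6 + i, by omega⟩ : Fin (φ.M * 6)).divNat = j := fun i =>
    Fin.ext (by simp [Fin.divNat]; omega)
  have h2 : ∀ i : Fin 6, (⟨j * 6 + i, by omega⟩ : Fin (φ.M * 6)).modNat = i := fun i =>
    Fin.ext (by simp [Fin.modNat])
  simp only [h1, h2]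
  simp [List.ofFn_succ]

theorem encode_getD {j i : ℕ} (hj : j < φ.M) (hi : i < 6) :
    φ.encode.getD (2 + (j * 6 + i)) 0 =
    ![((φ.clause ⟨j, hj⟩ 0).1 : ℕ), (φ.clause ⟨j, hj⟩ 0).2.toNat,
      ((φ.clause ⟨j, hj⟩ 1).1 : ℕ), (φ.clause ⟨j, hj⟩ 1).2.toNat,
      ((φ.clause ⟨j, hj⟩ 2).1 : ℕ), (φ.clause ⟨j, hj⟩ 2).2.toNat] ⟨i, hi⟩ := by
  have h1 : (⟨j * 6 + i, by omega⟩ : Fin (φ.M * 6)).divNat = ⟨j, hj⟩ :=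
    Fin.ext (by simp [Fin.divNat]; omega)
  have h2 : (⟨j * 6 + i, by omega⟩ : Fin (φ.M * 6)).modNat = ⟨i, hi⟩ :=
    Fin.ext (by simp [Fin.modNat]; omega)
  have h3 : j * 6 + i < φ.M * 6 := by omega
  rw [encode_eq, List.getD_eq_getElem?_getD, List.getElem?_append_right (by simp)]
  simp only [List.length_cons, List.length_nil, Nat.zero_add, Nat.reduceAdd,
    Nat.add_sub_cancel_left, List.getElem?_ofFn, h3, dite_true, Option.getD_some, h1, h2]

theorem var_slots {j : ℕ} (hj : j < φ.M) (l : Fin 3) :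
    φ.slots.var (3 * j + l) = (φ.clause ⟨j, hj⟩ l).1 := by
  have := φ.encode_getD hj (i := 2 * l) (by omega)
  rw [slots]
  dsimp only
  rw [show 2 + 2 * (3 * j + (l : ℕ)) = 2 + (j * 6 + 2 * l) by omega, this]
  fin_cases l <;> rfl

theorem sgn_slots {j : ℕ} (hj : j < φ.M) (l : Fin 3) :
    φ.slots.sgn (3 * j + l) = (φ.clause ⟨j, hj⟩ l).2.toNat := by
  have := φ.encode_getD hj (i := 2 * l + 1) (by omega)
  rw [slots]
  dsimp only
  rw [show 3 + 2 * (3 * j + (l : ℕ)) = 2 + (j * 6 + (2 * l + 1)) by omega, this]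
  fin_cases l <;> rfl

theorem sgn_slots_le {t : ℕ} (ht : t < 3 * φ.slots.M) : φ.slots.sgn t ≤ 1 := by
  have hj : t / 3 < φ.M := by
    have : φ.slots.M = φ.M := rfl
    omega
  have := φ.sgn_slots hj ⟨t % 3, Nat.mod_lt _ (by omega)⟩
  dsimp only at this
  rw [Nat.div_add_mod] at this
  rw [this]
  exact Bool.toNat_le _

theorem sat_slots {j : ℕ} (hj : j < φ.M) (α : ℕ → Bool) :
    φ.slots.Sat α j ↔ ∃ l, α (φ.clause ⟨j, hj⟩ l).1 = (φ.clause ⟨j, hj⟩ l).2 := by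
  constructor
  · rintro ⟨l, hl, h⟩
    refine ⟨⟨l, hl⟩, ?_⟩
    have h1 := φ.var_slots hj ⟨l, hl⟩
    have h2 := φ.sgn_slots hj ⟨l, hl⟩
    dsimp only at h1 h2
    rw [h1, h2] at h
    revert h
    cases α (φ.clause ⟨j, hj⟩ ⟨l, hl⟩).1 <;> cases (φ.clause ⟨j, hj⟩ ⟨l, hl⟩).2 <;> simp
  · rintro ⟨l, h⟩
    exact ⟨l, l.2, by rw [var_slots φ hj, sgn_slots φ hj, h]⟩

theorem card_filter_slots (P : ℕ → Prop) [DecidablePred P] :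
    ((Finset.range φ.M).filter P).card = (Finset.univ.filter fun j : Fin φ.M => P j).card := by
  rw [← Finset.card_image_of_injective _ Fin.val_injective]
  congr 1
  ext c
  simp only [Finset.mem_filter, Finset.mem_range, Finset.mem_image, Finset.mem_univ, true_and]
  constructor
  · rintro ⟨h, hp⟩
    exact ⟨⟨c, h⟩, hp, rfl⟩
  · rintro ⟨j, hp, rfl⟩
    exact ⟨j.2, hp⟩

open Classical in
theorem occurrences_slots {B : ℕ} (h : ∀ v, φ.occurrences v ≤ B) (v : ℕ) :
    ((Finset.range φ.slots.M).filter (φ.slots.Occurs v)).card ≤ B := by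
  refine (card_filter_slots φ (φ.slots.Occurs v)).trans_le ?_
  by_cases hv : v < φ.N
  · refine le_trans (Finset.card_le_card fun j hj => ?_) (h ⟨v, hv⟩)
    obtain ⟨l, hl, he⟩ := (Finset.mem_filter.1 hj).2
    refine Finset.mem_filter.2 ⟨Finset.mem_univ _, ⟨l, hl⟩, Fin.ext ?_⟩
    exact (φ.var_slots j.2 ⟨l, hl⟩).symm.trans he
  · rw [Finset.card_eq_zero.2 (Finset.filter_eq_empty_iff.2 ?_)]
    · exact Nat.zero_le _
    · rintro j - ⟨l, hl, he⟩
      have := φ.var_slots j.2 ⟨l, hl⟩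
      dsimp only at this
      rw [he] at this
      exact hv (this ▸ Fin.is_lt _)

theorem M_le_of_occurrences {B : ℕ} (h : ∀ v, φ.occurrences v ≤ B) : φ.M ≤ B * φ.N := by
  have h1 : (Finset.univ : Finset (Fin φ.M)) ⊆ Finset.univ.biUnion fun v : Fin φ.N =>
      Finset.univ.filter fun j : Fin φ.M => ∃ l, (φ.clause j l).1 = v := by
    intro j _
    exact Finset.mem_biUnion.2 ⟨(φ.clause j 0).1, Finset.mem_univ _, by simp⟩
  have h2 := (Finset.card_le_card h1).trans (Finset.card_biUnion_le_card_mul _ _ B fun v _ => h v)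
  simpa [mul_comm] using h2

end Formula

/-! ### Arithmetic and logic in the term language -/

namespace RAM.Tm

variable {V : ℕ} {m : Memory} {ρ : ℕ → ℕ}

@[simp] theorem eval_var (i : ℕ) : (var i).eval m ρ = ρ i := rfl
@[simp] theorem eval_const (n : ℕ) : (const n).eval m ρ = n := rfl
@[simp] theorem eval_read (a : ℕ) (h : a ≠ 2) (x : Tm) :
    (read a h x).eval m ρ = m a (x.eval m ρ) := rfl
@[simp] theorem eval_add (x y : Tm) : (add x y).eval m ρ = x.eval m ρ + y.eval m ρ := rfl
@[simp] theorem eval_sub (x y : Tm) : (sub x y).eval m ρ = x.eval m ρ - y.eval m ρ := rfl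
@[simp] theorem eval_ite (x y z : Tm) :
    (ite x y z).eval m ρ = if x.eval m ρ ≠ 0 then y.eval m ρ else z.eval m ρ := rfl
@[simp] theorem eval_ren (g : ℕ → ℕ) (x : Tm) :
    (ren g x).eval m ρ = x.eval m fun i => ρ (g i) := rfl
@[simp] theorem bdd_const (n : ℕ) : (const n).Bdd V m ρ := trivial
@[simp] theorem bdd_add (x y : Tm) : (add x y).Bdd V m ρ ↔ x.Bdd V m ρ ∧ y.Bdd V m ρ := .rfl
@[simp] theorem bdd_sub (x y : Tm) : (sub x y).Bdd V m ρ ↔ x.Bdd V m ρ ∧ y.Bdd V m ρ := .rfl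
@[simp] theorem bdd_ite (x y z : Tm) :
    (ite x y z).Bdd V m ρ ↔ x.Bdd V m ρ ∧ y.Bdd V m ρ ∧ z.Bdd V m ρ := .rfl
@[simp] theorem bdd_ren (g : ℕ → ℕ) (x : Tm) :
    (ren g x).Bdd V m ρ ↔ x.Bdd V m fun i => ρ (g i) := .rfl

/-- The renaming that makes room for one variable in front. -/
def up1 (x : Tm) : Tm := ren (fun i => i + 1) x

/-- The renaming that makes room for two variables in front. -/
def up2 (x : Tm) : Tm := ren (fun i => i + 2) x

@[simp] theorem eval_up1 (x : Tm) (v : ℕ) : x.up1.eval m (push v ρ) = x.eval m ρ := rfl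
@[simp] theorem eval_up2 (x : Tm) (v i : ℕ) :
    x.up2.eval m (push v (push i ρ)) = x.eval m ρ := rfl
@[simp] theorem bdd_up1 (x : Tm) (v : ℕ) :
    x.up1.Bdd V m (push v ρ) ↔ x.Bdd V m ρ := .rfl

/-- A term in a single loop counter, inside a loop body, where the counter is variable `1`. -/
def body (x : Tm) : Tm := ren (fun | 0 => 1 | i + 1 => i + 2) x

@[simp] theorem eval_body (x : Tm) (v i : ℕ) :
    x.body.eval m (push v (push i ρ)) = x.eval m (push i ρ) := by
  rw [body, eval_ren]
  congr 1
  funext j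
  cases j <;> rfl

@[simp] theorem bdd_body (x : Tm) (v i : ℕ) :
    x.body.Bdd V m (push v (push i ρ)) ↔ x.Bdd V m (push i ρ) := by
  rw [body, bdd_ren]
  apply iff_of_eq
  congr 1
  funext j
  cases j <;> rfl

/-- Multiplication. -/
def mul (x y : Tm) : Tm := fold x (const 0) (add (var 0) y.up2)

@[simp] theorem eval_mul (x y : Tm) : (mul x y).eval m ρ = x.eval m ρ * y.eval m ρ := by
  have : ∀ n : ℕ, (Nat.rec 0 (fun _ v => v + y.eval m ρ) n : ℕ) = n * y.eval m ρ := by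
    intro n
    induction n with
    | zero => simp
    | succ n ih => rw [add_mul, one_mul, ← ih]
  exact this _

theorem bdd_mul {x y : Tm} (hx : x.Bdd V m ρ) (hy : y.Bdd V m ρ) (h : x.eval m ρ ≤ V) :
    (mul x y).Bdd V m ρ :=
  ⟨hx, trivial, h, fun _ _ => ⟨trivial, hy⟩⟩

/-- Division. -/
def div (x y : Tm) : Tm :=
  ite y (fold x (const 0)
    (ite (sub (mul (add (var 0) (const 1)) y.up2) x.up2) (var 0) (add (var 0) (const 1))))
    (const 0)

theorem div_iter (x y : ℕ) (hy : 0 < y) (n : ℕ) :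
    (Nat.rec 0 (fun _ v => if (v + 1) * y - x ≠ 0 then v else v + 1) n : ℕ) = min n (x / y) := by
  induction n with
  | zero => simp
  | succ n ih =>
    change (if ((Nat.rec 0 (fun _ v => if (v + 1) * y - x ≠ 0 then v else v + 1) n : ℕ) + 1) * y
      - x ≠ 0 then (Nat.rec 0 (fun _ v => if (v + 1) * y - x ≠ 0 then v else v + 1) n : ℕ)
      else (Nat.rec 0 (fun _ v => if (v + 1) * y - x ≠ 0 then v else v + 1) n : ℕ) + 1) = _
    rw [ih]
    have key := Nat.le_div_iff_mul_le (x := min n (x / y) + 1) (y := x) hy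
    split_ifs with hc
    · have : ¬ min n (x / y) + 1 ≤ x / y := by rw [key]; omega
      omega
    · have : min n (x / y) + 1 ≤ x / y := by rw [key]; omega
      omega

@[simp] theorem eval_div (x y : Tm) : (div x y).eval m ρ = x.eval m ρ / y.eval m ρ := by
  rw [div, eval_ite, eval_const]
  split_ifs with h
  · have h1 := div_iter (x.eval m ρ) (y.eval m ρ) (Nat.pos_of_ne_zero h) (x.eval m ρ)
    rw [min_eq_right (Nat.div_le_self _ _)] at h1
    rw [← h1, eval]
    simp only [eval_ite, eval_sub, eval_mul, eval_add, eval_var, eval_const, eval_up2, push_zero]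
  · rw [not_not] at h
    simp [h]

theorem bdd_div {x y : Tm} (hx : x.Bdd V m ρ) (hy : y.Bdd V m ρ) (h : x.eval m ρ ≤ V) :
    (div x y).Bdd V m ρ := by
  refine ⟨hy, ⟨hx, trivial, h, fun j hj => ⟨⟨bdd_mul ⟨trivial, trivial⟩ hy ?_, hx⟩, trivial,
    trivial, trivial⟩⟩, trivial⟩
  -- the quotient so far is at most the number of iterations
  have h1 : ∀ j, iter m (const 0) (ite (sub (mul (add (var 0) (const 1)) y.up2) x.up2) (var 0)
      (add (var 0) (const 1))) ρ j ≤ j := by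
    intro j
    induction j with
    | zero => exact le_rfl
    | succ j ih =>
      change Tm.eval m _ _ ≤ _
      rw [eval_ite]
      split_ifs
      · exact ih.trans (Nat.le_succ _)
      · exact Nat.succ_le_succ ih
  have := h1 j
  simp only [eval_add, eval_var, eval_const, push_zero]
  omega

/-- The remainder. -/
def mod (x y : Tm) : Tm := sub x (mul (div x y) y)

@[simp] theorem eval_mod (x y : Tm) : (mod x y).eval m ρ = x.eval m ρ % y.eval m ρ := by
  rw [mod, eval_sub, eval_mul, eval_div, mul_comm, ← Nat.mod_eq_sub_mul_div]

theorem bdd_mod {x y : Tm} (hx : x.Bdd V m ρ) (hy : y.Bdd V m ρ) (h : x.eval m ρ ≤ V) :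
    (mod x y).Bdd V m ρ :=
  ⟨hx, bdd_mul (bdd_div hx hy h) hy (by rw [eval_div]; exact (Nat.div_le_self _ _).trans h)⟩

/-- The power of two. -/
def twoPow (x : Tm) : Tm := fold x (const 1) (add (var 0) (var 0))

@[simp] theorem eval_twoPow (x : Tm) : (twoPow x).eval m ρ = 2 ^ x.eval m ρ := by
  have : ∀ n : ℕ, (Nat.rec 1 (fun _ v => v + v) n : ℕ) = 2 ^ n := by
    intro n
    induction n with
    | zero => simp
    | succ n ih => rw [pow_succ, ← ih]; ring
  exact this _

theorem bdd_twoPow {x : Tm} (hx : x.Bdd V m ρ) (h : x.eval m ρ ≤ V) : (twoPow x).Bdd V m ρ :=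
  ⟨hx, trivial, h, fun _ _ => ⟨trivial, trivial⟩⟩

/-- `x < y` as a truth value. -/
def lt (x y : Tm) : Tm := ite (sub y x) (const 1) (const 0)

/-- `x = y` as a truth value. -/
def eq (x y : Tm) : Tm := ite (add (sub x y) (sub y x)) (const 0) (const 1)

/-- Conjunction. -/
def and (x y : Tm) : Tm := ite x y (const 0)

/-- Disjunction. -/
def or (x y : Tm) : Tm := ite x (const 1) y

/-- There is an `i` below the value of `n` (variable `0` in `x`) for which `x` is nonzero. -/
def ex (n x : Tm) : Tm := fold n (const 0) (ite x.body (const 1) (var 0))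

/-- The number of all `i` below the value of `n` for which `x` is nonzero. -/
def count (n x : Tm) : Tm := fold n (const 0) (add (var 0) (ite x.body (const 1) (const 0)))

/-- The last `i` below the value of `n` for which `x` is nonzero. -/
def last (n x : Tm) : Tm := fold n (const 0) (ite x.body (var 1) (var 0))

/-- The value of a term as a truth value. -/
def Holds (m : Memory) (x : Tm) (ρ : ℕ → ℕ) : Prop := x.eval m ρ ≠ 0

@[simp] theorem holds_lt (x y : Tm) : (lt x y).Holds m ρ ↔ x.eval m ρ < y.eval m ρ := by
  rw [Holds, lt, eval_ite]
  split_ifs with hc <;> simp only [eval_sub] at hc <;> simp only [eval_const] <;> omega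

@[simp] theorem holds_eq (x y : Tm) : (eq x y).Holds m ρ ↔ x.eval m ρ = y.eval m ρ := by
  rw [Holds, eq, eval_ite]
  split_ifs with hc <;> simp only [eval_add, eval_sub] at hc <;> simp only [eval_const] <;> omega

@[simp] theorem holds_and (x y : Tm) : (and x y).Holds m ρ ↔ x.Holds m ρ ∧ y.Holds m ρ := by
  simp only [Holds, and, eval_ite, eval_const]
  split_ifs <;> tauto

@[simp] theorem holds_or (x y : Tm) : (or x y).Holds m ρ ↔ x.Holds m ρ ∨ y.Holds m ρ := by
  simp only [Holds, or, eval_ite, eval_const]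
  split_ifs <;> simp_all

open Classical in
theorem eval_ite_holds (x y z : Tm) :
    (ite x y z).eval m ρ = if x.Holds m ρ then y.eval m ρ else z.eval m ρ := by
  rw [eval_ite]
  exact if_congr Iff.rfl rfl rfl

@[simp] theorem holds_ex (n x : Tm) :
    (ex n x).Holds m ρ ↔ ∃ i < n.eval m ρ, x.Holds m (push i ρ) := by
  have : ∀ k : ℕ, (Nat.rec 0 (fun i v => if x.eval m (push i ρ) ≠ 0 then 1 else v) k : ℕ) ≠ 0 ↔
      ∃ i < k, x.Holds m (push i ρ) := by
    intro k
    induction k with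
    | zero => simp
    | succ k ih =>
      change (if x.eval m (push k ρ) ≠ 0 then 1 else _) ≠ 0 ↔ _
      split_ifs with h
      · exact ⟨fun _ => ⟨k, k.lt_succ_self, h⟩, fun _ => one_ne_zero⟩
      · refine ih.trans ⟨fun ⟨i, hi, hx⟩ => ⟨i, hi.trans k.lt_succ_self, hx⟩, ?_⟩
        rintro ⟨i, hi, hx⟩
        rcases Nat.lt_succ_iff_lt_or_eq.1 hi with hi | rfl
        · exact ⟨i, hi, hx⟩
        · exact absurd hx h
  refine Iff.trans ?_ (this (n.eval m ρ))
  rw [Holds, ex, eval]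
  simp only [eval_ite, eval_body, eval_const, eval_var, push_zero]

open Classical in
theorem eval_count (n x : Tm) :
    (count n x).eval m ρ =
      ((Finset.range (n.eval m ρ)).filter fun i => x.Holds m (push i ρ)).card := by
  have : ∀ k : ℕ, (Nat.rec 0 (fun i v => v + if x.eval m (push i ρ) ≠ 0 then 1 else 0) k : ℕ) =
      ((Finset.range k).filter fun i => x.Holds m (push i ρ)).card := by
    intro k
    induction k with
    | zero => simp
    | succ k ih =>
      rw [Finset.range_add_one, Finset.filter_insert]
      change _ + (if x.eval m (push k ρ) ≠ 0 then 1 else 0) = _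
      rw [ih]
      by_cases h : x.Holds m (push k ρ)
      · rw [if_pos h, if_pos (show x.eval m (push k ρ) ≠ 0 from h), Finset.card_insert_of_notMem (by simp)]
      · rw [if_neg h, if_neg (show ¬ x.eval m (push k ρ) ≠ 0 from h), add_zero]
  rw [← this, count, eval]
  simp only [eval_add, eval_ite, eval_body, eval_const, eval_var, push_zero]

theorem eval_last (n x : Tm) (p : ℕ → Prop) [DecidablePred p]
    (h : ∀ i, x.Holds m (push i ρ) ↔ p i) :
    (last n x).eval m ρ = SlotTable.lastIndex p (n.eval m ρ) := by
  rw [last, eval, SlotTable.lastIndex]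
  congr 1
  funext i v
  rw [eval_ite]
  simp only [eval_body, eval_var, push_zero, push_one]
  exact if_congr (h i) rfl rfl

theorem bdd_lt {x y : Tm} (hx : x.Bdd V m ρ) (hy : y.Bdd V m ρ) : (lt x y).Bdd V m ρ := by
  simp [lt, hx, hy]

theorem bdd_eq {x y : Tm} (hx : x.Bdd V m ρ) (hy : y.Bdd V m ρ) : (eq x y).Bdd V m ρ := by
  simp [eq, hx, hy]

theorem bdd_and {x y : Tm} (hx : x.Bdd V m ρ) (hy : y.Bdd V m ρ) : (and x y).Bdd V m ρ := by
  simp [and, hx, hy]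

theorem bdd_or {x y : Tm} (hx : x.Bdd V m ρ) (hy : y.Bdd V m ρ) : (or x y).Bdd V m ρ := by
  simp [or, hx, hy]

theorem bdd_ex {n x : Tm} (hn : n.Bdd V m ρ) (h : n.eval m ρ ≤ V)
    (hx : ∀ i < n.eval m ρ, x.Bdd V m (push i ρ)) : (ex n x).Bdd V m ρ :=
  ⟨hn, trivial, h, fun i hi => ⟨(bdd_body _ _ _).2 (hx i hi), trivial, trivial⟩⟩

theorem bdd_count {n x : Tm} (hn : n.Bdd V m ρ) (h : n.eval m ρ ≤ V)
    (hx : ∀ i < n.eval m ρ, x.Bdd V m (push i ρ)) : (count n x).Bdd V m ρ :=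
  ⟨hn, trivial, h, fun i hi => ⟨trivial, (bdd_body _ _ _).2 (hx i hi), trivial, trivial⟩⟩

theorem bdd_last {n x : Tm} (hn : n.Bdd V m ρ) (h : n.eval m ρ ≤ V)
    (hx : ∀ i < n.eval m ρ, x.Bdd V m (push i ρ)) : (last n x).Bdd V m ρ :=
  ⟨hn, trivial, h, fun i hi => ⟨(bdd_body _ _ _).2 (hx i hi), trivial, trivial⟩⟩

end RAM.Tm

/-! ### The reduction in the term language -/

namespace RAM.Tm

variable (k B Q : ℕ)

/-- The slot table of the formula that array `0` encodes. -/
def slotsOf (m : Memory) : SlotTable where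
  M := m 0 1
  var t := m 0 (2 + 2 * t)
  sgn t := m 0 (3 + 2 * t)

/-- The number of clauses. -/
def tM : Tm := read 0 (by decide) (const 1)

/-- The number of groups. -/
def tK : Tm := sub (const k) (sub (const k) (add tM (const 1)))

/-- The bound on the number of clauses in a group. -/
def ts : Tm := add (div tM (tK k)) (const 1)

/-- The number of candidate centers in a row. -/
def tL : Tm := twoPow (mul (const 3) (ts k))

/-- The number of elements for each row. -/
def tD : Tm := mul (const (3 * B)) (ts k)

/-- The number of copies of an element. -/
def tW : Tm := mul (tK k) (tL k)

/-- The offset of the first copy of an element in a row. -/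
def tLW : Tm := add (tL k) (mul (tW k) (tD k B))

/-- The capacity. -/
def tU : Tm := add (tLW k B) (mul (tW k) (tD k B))

/-- The number of points. -/
def tn : Tm := mul (tK k) (tU k B)

/-- The variable in a slot. -/
def tvar (t : Tm) : Tm := read 0 (by decide) (add (const 2) (mul (const 2) t))

/-- The sign in a slot. -/
def tsgn (t : Tm) : Tm := read 0 (by decide) (add (const 3) (mul (const 2) t))

/-- The owner of a variable. -/
def towner (v : Tm) : Tm := last (mul (const 3) tM) (eq (tvar (var 0)) v.up1)

/-- The group of a slot. -/
def tgroup (t : Tm) : Tm := mod (div t (const 3)) (tK k)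

/-- The place of a slot in its group. -/
def tplace (t : Tm) : Tm :=
  add (mul (const 3) (div (div t (const 3)) (tK k))) (mod t (const 3))

/-- The literal that is number `l` of the clause `c` is satisfied by the candidate center `a` of
group `i`. -/
def tlit (i a c l : Tm) : Tm :=
  and (eq (tgroup k (towner (tvar (add (mul (const 3) c) l)))) i)
    (eq (mod (div a (twoPow (tplace k (towner (tvar (add (mul (const 3) c) l)))))) (const 2))
      (tsgn (add (mul (const 3) c) l)))

/-- The cover relation. -/
def tcov (i a c : Tm) : Tm :=
  or (lt tM (add c (const 1))) (ex (const 3) (tlit k i.up1 a.up1 c.up1 (var 0)))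

/-- The element of which a point is a copy. -/
def telem (p : Tm) : Tm :=
  add (mul (div p (tU k B)) (tD k B)) (div (sub (mod p (tU k B)) (tLW k B)) (tW k))

/-- The relation between candidate centers and their neighbors. -/
def tcovers (p q : Tm) : Tm :=
  and (lt (mod p (tU k B)) (tL k))
    (or (and (eq (div p (tU k B)) (div q (tU k B))) (lt (mod q (tU k B)) (tLW k B)))
      (and (lt (tLW k B) (add (mod q (tU k B)) (const 1)))
        (tcov k (div p (tU k B)) (mod p (tU k B)) (telem k B q))))

/-- The distance. -/
def tdist (p q : Tm) : Tm :=
  ite (eq p q) (const 0) (ite (or (tcovers k B p q) (tcovers k B q p)) (const 1) (const 2))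

/-- The length of the encoding of the gap instance. -/
def tlength : Tm := add (const 3) (mul (tn k B) (tn k B))

/-- The entry of the encoding of the gap instance whose index is variable `0`. -/
def tentry : Tm :=
  ite (lt (var 0) (const 3))
    (ite (eq (var 0) (const 0)) (tn k B) (ite (eq (var 0) (const 1)) (tK k) (tU k B)))
    (tdist k B (div (sub (var 0) (const 3)) (tn k B)) (mod (sub (var 0) (const 3)) (tn k B)))

/-- The number of clusters of radius `2` in the solution that array `4` describes. -/
def tfar : Tm :=
  count (tn k B) (ex (tn k B)
    (and (eq (read 4 (by decide) (var 0)) (var 1)) (eq (tdist k B (var 0) (var 1)) (const 2))))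

/-- The answer: there are at most `K / Q` clusters of radius `2`. -/
def tanswer : Tm := ite (sub (mul (const Q) (tfar k B)) (tK k)) (const 0) (const 1)

variable {k B Q} {V : ℕ} {m : Memory} {ρ : ℕ → ℕ}

@[simp] theorem eval_tM : tM.eval m ρ = (slotsOf m).M := rfl

@[simp] theorem eval_tK : (tK k).eval m ρ = (slotsOf m).K k := by
  simp only [tK, eval_sub, eval_const, eval_add, eval_tM, SlotTable.K]
  omega

@[simp] theorem eval_ts : (ts k).eval m ρ = (slotsOf m).s k := by
  simp [ts, SlotTable.s]

@[simp] theorem eval_tL : (tL k).eval m ρ = ((slotsOf m).sizes k B).L := by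
  simp [tL, SlotTable.sizes]

@[simp] theorem eval_tD : (tD k B).eval m ρ = ((slotsOf m).sizes k B).D := by
  simp [tD, SlotTable.sizes]

@[simp] theorem eval_tW : (tW k).eval m ρ = ((slotsOf m).sizes k B).W := by
  simp [tW, SlotTable.sizes, eval_tL (B := B)]

@[simp] theorem eval_tLW : (tLW k B).eval m ρ =
    ((slotsOf m).sizes k B).L + ((slotsOf m).sizes k B).W * ((slotsOf m).sizes k B).D := by
  rw [tLW, eval_add, eval_mul, eval_tL (B := B), eval_tW (B := B), eval_tD]

@[simp] theorem eval_tU : (tU k B).eval m ρ = ((slotsOf m).sizes k B).U := by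
  rw [tU, eval_add, eval_mul, eval_tLW, eval_tW (B := B), eval_tD, Sizes.U]

@[simp] theorem eval_tn : (tn k B).eval m ρ =
    ((slotsOf m).sizes k B).K * ((slotsOf m).sizes k B).U := by
  rw [tn, eval_mul, eval_tU, eval_tK]
  rfl

@[simp] theorem eval_tvar (t : Tm) : (tvar t).eval m ρ = (slotsOf m).var (t.eval m ρ) := by
  simp [tvar, slotsOf]

@[simp] theorem eval_tsgn (t : Tm) : (tsgn t).eval m ρ = (slotsOf m).sgn (t.eval m ρ) := by
  simp [tsgn, slotsOf]

@[simp] theorem eval_towner (v : Tm) :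
    (towner v).eval m ρ = (slotsOf m).owner (v.eval m ρ) := by
  rw [towner, eval_last (p := fun t => (slotsOf m).var t = v.eval m ρ) (h := by simp)]
  simp [SlotTable.owner]

@[simp] theorem eval_tgroup (t : Tm) :
    (tgroup k t).eval m ρ = (slotsOf m).group k (t.eval m ρ) := by
  simp [tgroup, SlotTable.group]

@[simp] theorem eval_tplace (t : Tm) :
    (tplace k t).eval m ρ = (slotsOf m).place k (t.eval m ρ) := by
  simp [tplace, SlotTable.place]

@[simp] theorem holds_tcov (i a c : Tm) : (tcov k i a c).Holds m ρ ↔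
    (slotsOf m).cov k (i.eval m ρ) (a.eval m ρ) (c.eval m ρ) := by
  simp [tcov, tlit, SlotTable.cov, Nat.lt_succ_iff]

@[simp] theorem eval_telem (p : Tm) :
    (telem k B p).eval m ρ = ((slotsOf m).sizes k B).elem (p.eval m ρ) := by
  simp [telem, Sizes.elem, eval_tW (B := B)]

@[simp] theorem holds_tcovers (p q : Tm) : (tcovers k B p q).Holds m ρ ↔
    ((slotsOf m).sizes k B).Covers ((slotsOf m).cov k) (p.eval m ρ) (q.eval m ρ) := by
  simp [tcovers, Sizes.Covers, eval_tL (B := B)]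

@[simp] theorem eval_tdist (p q : Tm) : (tdist k B p q).eval m ρ =
    ((slotsOf m).sizes k B).dist ((slotsOf m).cov k) (p.eval m ρ) (q.eval m ρ) := by
  classical
  rw [tdist, eval_ite_holds, eval_ite_holds, Sizes.dist]
  simp only [holds_eq, holds_or, holds_tcovers, eval_const]

/-- `V` bounds all loops of the reduction. -/
structure Fits (k B V : ℕ) (m : Memory) : Prop where
  const_le : 3 * B + 3 ≤ V
  M_le : 3 * (slotsOf m).M + 2 ≤ V
  s_le : 3 * (slotsOf m).s k ≤ V
  K_le : (slotsOf m).K k ≤ V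
  W_le : ((slotsOf m).sizes k B).W ≤ V
  n_le : ((slotsOf m).sizes k B).K * ((slotsOf m).sizes k B).U ≤ V

theorem bdd_tM : tM.Bdd V m ρ := trivial

theorem bdd_tK : (tK k).Bdd V m ρ := by simp [tK, bdd_tM]

theorem bdd_tgroup {t : Tm} (ht : t.Bdd V m ρ) (h : t.eval m ρ ≤ V) : (tgroup k t).Bdd V m ρ :=
  bdd_mod (bdd_div ht trivial h) bdd_tK
    (by rw [eval_div]; exact (Nat.div_le_self _ _).trans h)

variable (hV : Fits k B V m)
include hV

theorem bdd_ts : (ts k).Bdd V m ρ :=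
  ⟨bdd_div bdd_tM bdd_tK (by have := hV.M_le; rw [eval_tM]; omega), trivial⟩

theorem three_le : 3 ≤ V := (Nat.le_add_left 3 (3 * B)).trans hV.const_le

theorem bdd_tL : (tL k).Bdd V m ρ :=
  bdd_twoPow (bdd_mul trivial (bdd_ts hV) (three_le hV)) (by simpa using hV.s_le)

theorem bdd_tD : (tD k B).Bdd V m ρ :=
  bdd_mul trivial (bdd_ts hV) (by have := hV.const_le; rw [eval_const]; omega)

theorem bdd_tW : (tW k).Bdd V m ρ :=
  bdd_mul bdd_tK (bdd_tL hV) (by simpa using hV.K_le)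

theorem bdd_tWD : (mul (tW k) (tD k B)).Bdd V m ρ :=
  bdd_mul (bdd_tW hV) (bdd_tD hV) (by simpa [eval_tW (B := B)] using hV.W_le)

theorem bdd_tLW : (tLW k B).Bdd V m ρ := ⟨bdd_tL hV, bdd_tWD hV⟩

theorem bdd_tU : (tU k B).Bdd V m ρ := ⟨bdd_tLW hV, bdd_tWD hV⟩

theorem bdd_tn : (tn k B).Bdd V m ρ :=
  bdd_mul bdd_tK (bdd_tU hV) (by simpa using hV.K_le)

theorem bdd_tvar {t : Tm} (ht : t.Bdd V m ρ) : (tvar t).Bdd V m ρ :=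
  ⟨trivial, bdd_mul trivial ht (by have := three_le hV; rw [eval_const]; omega)⟩

theorem bdd_tsgn {t : Tm} (ht : t.Bdd V m ρ) : (tsgn t).Bdd V m ρ :=
  ⟨trivial, bdd_mul trivial ht (by have := three_le hV; rw [eval_const]; omega)⟩

theorem bdd_towner {v : Tm} (hv : v.Bdd V m ρ) : (towner v).Bdd V m ρ :=
  bdd_last (bdd_mul trivial bdd_tM (three_le hV))
    (by have := hV.M_le; simp only [eval_mul, eval_const, eval_tM]; omega)
    fun _ _ => bdd_eq (bdd_tvar hV trivial) ((bdd_up1 _ _).2 hv)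

theorem bdd_tplace {t : Tm} (ht : t.Bdd V m ρ) (h : t.eval m ρ ≤ V) : (tplace k t).Bdd V m ρ :=
  ⟨bdd_mul trivial (bdd_div (bdd_div ht trivial h) bdd_tK
    (by rw [eval_div]; exact (Nat.div_le_self _ _).trans h)) (three_le hV), bdd_mod ht trivial h⟩

theorem bdd_tlit {i a c l : Tm} (hi : i.Bdd V m ρ) (ha : a.Bdd V m ρ) (hc : c.Bdd V m ρ)
    (hl : l.Bdd V m ρ) (h : a.eval m ρ ≤ V) : (tlit k i a c l).Bdd V m ρ := by
  have ht : (add (mul (const 3) c) l).Bdd V m ρ := ⟨bdd_mul trivial hc (three_le hV), hl⟩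
  have ho := bdd_towner hV (bdd_tvar hV ht)
  have hoM : (towner (tvar (add (mul (const 3) c) l))).eval m ρ ≤ 3 * (slotsOf m).M := by
    rw [eval_towner]
    exact SlotTable.lastIndex_le _ _
  have hoV := hoM.trans ((Nat.le_add_right _ 2).trans hV.M_le)
  refine bdd_and (bdd_eq (bdd_tgroup ho hoV) hi) (bdd_eq (bdd_mod (bdd_div ha (bdd_twoPow
    (bdd_tplace hV ho hoV) ?_) h) trivial ?_) (bdd_tsgn hV ht))
  · rw [eval_tplace, SlotTable.place]
    have h1 := Nat.div_le_self ((towner (tvar (add (mul (const 3) c) l))).eval m ρ / 3)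
      ((slotsOf m).K k)
    have := hV.M_le
    omega
  · rw [eval_div]
    exact (Nat.div_le_self _ _).trans h

theorem bdd_tcov {i a c : Tm} (hi : i.Bdd V m ρ) (ha : a.Bdd V m ρ) (hc : c.Bdd V m ρ)
    (h : a.eval m ρ ≤ V) : (tcov k i a c).Bdd V m ρ :=
  bdd_or (bdd_lt bdd_tM ⟨hc, trivial⟩) (bdd_ex trivial (three_le hV) fun _ _ =>
    bdd_tlit hV ((bdd_up1 _ _).2 hi) ((bdd_up1 _ _).2 ha) ((bdd_up1 _ _).2 hc) trivial
      (by simpa using h))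

theorem bdd_tcovers {p q : Tm} (hp : p.Bdd V m ρ) (hq : q.Bdd V m ρ) (h : p.eval m ρ ≤ V)
    (h' : q.eval m ρ ≤ V) : (tcovers k B p q).Bdd V m ρ := by
  have hpd := bdd_div hp (bdd_tU hV) h
  have hqd := bdd_div hq (bdd_tU hV) h'
  have hpm := bdd_mod hp (bdd_tU hV) h
  have hqm := bdd_mod hq (bdd_tU hV) h'
  have hem : (telem k B q).Bdd V m ρ :=
    ⟨bdd_mul hqd (bdd_tD hV) (by rw [eval_div]; exact (Nat.div_le_self _ _).trans h'),
      bdd_div ⟨hqm, bdd_tLW hV⟩ (bdd_tW hV)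
        (by
          rw [eval_sub, eval_mod]
          exact (Nat.sub_le _ _).trans ((Nat.mod_le _ _).trans h'))⟩
  exact bdd_and (bdd_lt hpm (bdd_tL hV)) (bdd_or (bdd_and (bdd_eq hpd hqd)
    (bdd_lt hqm (bdd_tLW hV))) (bdd_and (bdd_lt (bdd_tLW hV) ⟨hqm, trivial⟩)
      (bdd_tcov hV hpd hpm hem (by rw [eval_mod]; exact (Nat.mod_le _ _).trans h))))

theorem bdd_tdist {p q : Tm} (hp : p.Bdd V m ρ) (hq : q.Bdd V m ρ) (h : p.eval m ρ ≤ V)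
    (h' : q.eval m ρ ≤ V) : (tdist k B p q).Bdd V m ρ :=
  ⟨bdd_eq hp hq, trivial, bdd_or (bdd_tcovers hV hp hq h h') (bdd_tcovers hV hq hp h' h), trivial,
    trivial⟩

theorem bdd_tlength : (tlength k B).Bdd V m ρ :=
  ⟨trivial, bdd_mul (bdd_tn hV) (bdd_tn hV) (by simpa using hV.n_le)⟩

theorem bdd_tentry (h : ρ 0 ≤ V) : (tentry k B).Bdd V m ρ := by
  have h3 : (sub (var 0) (const 3)).eval m ρ ≤ V := (Nat.sub_le _ _).trans h
  refine ⟨bdd_lt trivial trivial, ⟨bdd_eq trivial trivial, bdd_tn hV, bdd_eq trivial trivial,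
    bdd_tK, bdd_tU hV⟩, bdd_tdist hV (bdd_div ⟨trivial, trivial⟩ (bdd_tn hV) h3)
    (bdd_mod ⟨trivial, trivial⟩ (bdd_tn hV) h3) ?_ ?_⟩
  · rw [eval_div]
    exact (Nat.div_le_self _ _).trans h3
  · rw [eval_mod]
    exact (Nat.mod_le _ _).trans h3

theorem bdd_tanswer (hQ : Q ≤ V) : (tanswer k B Q).Bdd V m ρ := by
  refine ⟨⟨bdd_mul trivial (bdd_count (bdd_tn hV) (by simpa using hV.n_le) fun i hi =>
    bdd_ex (bdd_tn hV) (by simpa using hV.n_le) fun j hj => ?_) hQ, bdd_tK⟩, trivial, trivial⟩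
  rw [eval_tn] at hi hj
  exact bdd_and (bdd_eq trivial trivial) (bdd_eq (bdd_tdist hV trivial trivial
    (hj.le.trans hV.n_le) (hi.le.trans hV.n_le)) trivial)

omit hV

open Classical in
theorem eval_tfar : (tfar k B).eval m ρ =
    ((Finset.range (((slotsOf m).sizes k B).K * ((slotsOf m).sizes k B).U)).filter fun s =>
      ∃ p < ((slotsOf m).sizes k B).K * ((slotsOf m).sizes k B).U, m 4 p = s ∧
        ((slotsOf m).sizes k B).dist ((slotsOf m).cov k) p s = 2).card := by
  rw [tfar, eval_count, eval_tn]
  simp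

/-! ### The constants of the reduction do not influence the running time -/

theorem time_tK : (tK k).time V = (tK 0).time V := by
  simp only [tK, time]

theorem time_ts : (ts k).time V = (ts 0).time V := by
  simp only [ts, div, mul, up2, time, time_tK (k := k)]

theorem time_tL : (tL k).time V = (tL 0).time V := by
  simp only [tL, twoPow, mul, up2, time, time_ts (k := k)]

theorem time_tD : (tD k B).time V = (tD 0 0).time V := by
  simp only [tD, mul, up2, time, time_ts (k := k)]

theorem time_tW : (tW k).time V = (tW 0).time V := by
  simp only [tW, mul, up2, time, time_tK (k := k), time_tL (k := k)]

theorem time_tLW : (tLW k B).time V = (tLW 0 0).time V := by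
  simp only [tLW, mul, up2, time, time_tL (k := k), time_tW (k := k), time_tD (k := k)]

theorem time_tU : (tU k B).time V = (tU 0 0).time V := by
  simp only [tU, mul, up2, time, time_tLW (k := k), time_tW (k := k), time_tD (k := k)]

theorem time_tn : (tn k B).time V = (tn 0 0).time V := by
  simp only [tn, mul, up2, time, time_tK (k := k), time_tU (k := k)]

theorem time_tcov {i i' a a' c c' : Tm} (hi : i.time V = i'.time V) (ha : a.time V = a'.time V)
    (hc : c.time V = c'.time V) : (tcov k i a c).time V = (tcov 0 i' a' c').time V := by
  simp only [tcov, tlit, tgroup, tplace, towner, tvar, tsgn, last, ex, or, lt, and, eq, mod, div,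
    twoPow, mul, up1, up2, body, time, time_tK (k := k), hi, ha, hc]

theorem time_div_tU {x x' : Tm} (h : x.time V = x'.time V) :
    (div x (tU k B)).time V = (div x' (tU 0 0)).time V := by
  simp only [div, mul, up2, time, time_tU (k := k), h]

theorem time_mod_tU {x x' : Tm} (h : x.time V = x'.time V) :
    (mod x (tU k B)).time V = (mod x' (tU 0 0)).time V := by
  simp only [mod, mul, up2, time, time_tU (k := k), time_div_tU (k := k) h, h]

theorem time_tcovers {p p' q q' : Tm} (hp : p.time V = p'.time V) (hq : q.time V = q'.time V) :
    (tcovers k B p q).time V = (tcovers 0 0 p' q').time V := by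
  have he : (telem k B q).time V = (telem 0 0 q').time V := by
    simp only [telem, mul, up2, time, time_tD (k := k), time_tLW (k := k),
      time_mod_tU (k := k) hq, div, time_tU (k := k), time_tW (k := k), hq]
  simp only [tcovers, and, or, lt, eq, time, time_div_tU (k := k) hp, time_mod_tU (k := k) hp,
    time_div_tU (k := k) hq, time_mod_tU (k := k) hq, time_tL (k := k), time_tLW (k := k),
    time_tcov (k := k) (time_div_tU (k := k) (B := B) hp) (time_mod_tU (k := k) hp) he]

theorem time_tdist {p p' q q' : Tm} (hp : p.time V = p'.time V) (hq : q.time V = q'.time V) :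
    (tdist k B p q).time V = (tdist 0 0 p' q').time V := by
  simp only [tdist, or, eq, time, time_tcovers (k := k) hp hq, time_tcovers (k := k) hq hp, hp, hq]

theorem time_tlength : (tlength k B).time V = (tlength 0 0).time V := by
  simp only [tlength, mul, up2, time, time_tn (k := k)]

theorem time_tentry : (tentry k B).time V = (tentry 0 0).time V := by
  have hd : ∀ x, (div x (tn k B)).time V = (div x (tn 0 0)).time V := fun x => by
    simp only [div, mul, up2, time, time_tn (k := k)]
  have hm : ∀ x, (mod x (tn k B)).time V = (mod x (tn 0 0)).time V := fun x => by
    simp only [mod, mul, up2, time, time_tn (k := k), hd]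
  simp only [tentry, lt, eq, time, time_tn (k := k), time_tK (k := k), time_tU (k := k),
    time_tdist (k := k) (hd _) (hm _)]

theorem time_tanswer : (tanswer k B Q).time V = (tanswer 0 0 0).time V := by
  simp only [tanswer, tfar, count, ex, body, mul, up2, and, eq, time,
    time_tdist (k := k) (p := var 0) (q := var 1) rfl rfl, time_tn (k := k), time_tK (k := k)]

end RAM.Tm

/-! ### The program -/

namespace RAM

open Tm

/-- A program that writes the values of `x`, for the values of variable `0` that are less than the
value of `n`, to array `3`. -/
def fill (n x : Tm) : Cmd :=
  .seq (.store 2 (.const 0) (.const 0)) (.seq (n.compile 1 fun _ => 0)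
    (.loop (.sub (tmp 1) (tmp 0)) (.seq (x.compile 2 fun _ => 0)
      (.seq (.store 3 (tmp 0) (tmp 2)) (.store 2 (.const 0) (.add (tmp 0) (.const 1)))))))

theorem fill_spec (ω : Coins) (pos V N : ℕ) (n x : Tm) (v inp : ℕ → ℕ)
    (hn : ∀ m : Memory, m 0 = inp → n.eval m (fun _ => 0) = N ∧ n.Bdd V m fun _ => 0)
    (hx : ∀ m : Memory, m 0 = inp → ∀ j < N,
      x.eval m (fun _ => j) = v j ∧ x.Bdd V m fun _ => j)
    (m : Memory) (hm₀ : m 0 = inp) (hm₃ : ∀ i, m 3 i = 0) :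
    ∃ (m' : Memory) (t : ℕ), Exec ω (fill n x) ⟨m, pos⟩ ⟨m', pos⟩ t ∧
      t ≤ n.time V + N * (x.time V + 20) + 20 ∧ (∀ a, a ≠ 2 → a ≠ 3 → m' a = m a) ∧
      ∀ i, m' 3 i = if i < N then v i else 0 := by
  have wr : ∀ (m : Memory) (a i v b : ℕ), b ≠ a → m.write a i v b = m b := by
    intro m a i v b h
    funext j
    simp [Memory.write, h]
  have wr2 : ∀ (m : Memory) (a i v j : ℕ),
      m.write a i v a j = if j = i then v else m a j := by
    intro m a i v j
    simp [Memory.write]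
  -- the loop, entered with `r` iterations to go
  have key : ∀ (r j : ℕ) (m₁ : Memory), j + r = N → (∀ a, a ≠ 2 → a ≠ 3 → m₁ a = m a) →
      (∀ i, m₁ 3 i = if i < j then v i else 0) → m₁ 2 0 = j → m₁ 2 1 = N →
      ∃ (m' : Memory) (t : ℕ), Exec ω (.loop (.sub (tmp 1) (tmp 0))
        (.seq (x.compile 2 fun _ => 0) (.seq (.store 3 (tmp 0) (tmp 2))
          (.store 2 (.const 0) (.add (tmp 0) (.const 1)))))) ⟨m₁, pos⟩ ⟨m', pos⟩ t ∧
        t ≤ r * (x.time V + 20) + 6 ∧ (∀ a, a ≠ 2 → a ≠ 3 → m' a = m a) ∧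
        ∀ i, m' 3 i = if i < N then v i else 0 := by
    intro r
    induction r with
    | zero =>
      intro j m₁ hj hm₁ h3 h0 h1
      refine ⟨m₁, _, .loop_false ?_, ?_, hm₁, ?_⟩
      · simp [Expr.eval, h0, h1]; omega
      · simp [Expr.cost]
      · simpa [show j = N by omega] using h3
    | succ r ih =>
      intro j m₁ hj hm₁ h3 h0 h1
      obtain ⟨hv, hb⟩ := hx m₁ ((hm₁ 0 (by omega) (by omega)).trans hm₀) j (by omega)
      obtain ⟨m₂, t₂, h₂, ht₂, hv₂, hm₂, hlow⟩ := compile_spec ω pos V m₁ x 2 (fun _ => 0)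
        (fun _ => j) m₁ (fun _ => by omega) (fun _ _ => rfl) (fun _ => h0) hb
      have h20 : m₂ 2 0 = j := (hlow 0 (by omega)).trans h0
      have h21 : m₂ 2 1 = N := (hlow 1 (by omega)).trans h1
      obtain ⟨m', t', h', ht', hm', h3'⟩ := ih (j + 1)
        ((m₂.write 3 (m₂ 2 0) (m₂ 2 2)).write 2 0 ((m₂.write 3 (m₂ 2 0) (m₂ 2 2)) 2 0 + 1))
        (by omega)
        (by
          intro a ha ha'
          rw [wr _ _ _ _ _ ha, wr _ _ _ _ _ ha', hm₂ a ha, hm₁ a ha ha'])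
        (by
          intro i
          rw [wr _ _ _ _ _ (by omega), wr2, h20, hm₂ 3 (by omega), h3, hv₂, hv]
          rcases lt_trichotomy i j with h | rfl | h
          · rw [if_neg (by omega), if_pos h, if_pos (by omega)]
          · rw [if_pos rfl, if_pos (by omega)]
          · rw [if_neg (by omega), if_neg (by omega), if_neg (by omega)])
        (by rw [wr2, if_pos rfl, wr _ _ _ _ _ (by omega), h20])
        (by rw [wr2, if_neg (by omega), wr _ _ _ _ _ (by omega), h21])
      refine ⟨m', _, .loop_true ?_ (.seq h₂ (.seq (.store _ _ _ _) (.store _ _ _ _))) h', ?_,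
        hm', h3'⟩
      · simp [Expr.eval, h0, h1]; omega
      · simp only [Expr.cost]
        rw [Nat.succ_mul]
        omega
  have hm₀' : (m.write 2 0 0) 0 = inp := by rw [wr _ _ _ _ _ (by omega), hm₀]
  obtain ⟨hv, hb⟩ := hn _ hm₀'
  obtain ⟨m₂, t₂, h₂, ht₂, hv₂, hm₂, hlow⟩ := compile_spec ω pos V (m.write 2 0 0) n 1
    (fun _ => 0) (fun _ => 0) (m.write 2 0 0) (fun _ => by omega) (fun _ _ => rfl)
    (fun _ => by simp [wr2]) hb
  obtain ⟨m', t', h', ht', hm', h3'⟩ := key N 0 m₂ (by omega)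
    (fun a ha _ => by rw [hm₂ a ha, wr _ _ _ _ _ ha])
    (fun i => by rw [hm₂ 3 (by omega), wr _ _ _ _ _ (by omega), hm₃]; simp)
    (by rw [hlow 0 (by omega), wr2, if_pos rfl]) (hv₂.trans hv)
  refine ⟨m', _, .seq (.store _ _ _ _) (.seq h₂ h'), ?_, hm', h3'⟩
  simp only [Expr.cost]
  omega

/-- The program that decides the gap problem for formulas with the help of the program `c` for
uniform capacitated sum of radii. -/
def program (k B Q : ℕ) (c : Cmd) : Cmd :=
  .seq (fill (tlength k B) (tentry k B)) (.seq c.shift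
    (.seq ((tanswer k B Q).compile 1 fun _ => 0) (.store 1 (.const 0) (tmp 1))))

/-- A bound on the running time of the program without that of `c`. -/
def overhead (k B Q V : ℕ) : ℕ :=
  (tlength k B).time V + V * ((tentry k B).time V + 20) + (tanswer k B Q).time V + 30

/-- The constants in the terms do not influence the running time. -/
theorem overhead_eq (k B Q V : ℕ) : overhead k B Q V = overhead 0 0 0 V := by
  simp only [overhead, time_tlength (k := k), time_tentry (k := k), time_tanswer (k := k)]

theorem overhead_le_poly :
    ∃ C d : ℕ, ∀ k B Q V : ℕ, 1 ≤ V → overhead k B Q V ≤ C * V ^ d := by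
  obtain ⟨C₁, d₁, h₁⟩ := (tlength 0 0).time_le_poly
  obtain ⟨C₂, d₂, h₂⟩ := (tentry 0 0).time_le_poly
  obtain ⟨C₃, d₃, h₃⟩ := (tanswer 0 0 0).time_le_poly
  refine ⟨C₁ + (C₂ + 20) + C₃ + 30, d₁ + (d₂ + 1) + d₃, fun k B Q V hV => ?_⟩
  rw [overhead_eq, overhead]
  have up : ∀ {C d : ℕ} (e : ℕ), d ≤ e → C * V ^ d ≤ C * V ^ e :=
    fun e h => Nat.mul_le_mul_left _ (Nat.pow_le_pow_right hV h)
  have e1 := (h₁ V hV).trans (up (d₁ + (d₂ + 1) + d₃) (by omega))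
  have e3 := (h₃ V hV).trans (up (d₁ + (d₂ + 1) + d₃) (by omega))
  have e2 : V * ((tentry 0 0).time V + 20) ≤ (C₂ + 20) * V ^ (d₁ + (d₂ + 1) + d₃) := by
    refine le_trans ?_ (up (d := d₂ + 1) _ (by omega))
    have h1 := h₂ V hV
    have h2 : 1 ≤ V ^ d₂ := Nat.one_le_pow _ _ hV
    calc V * ((tentry 0 0).time V + 20) ≤ V * ((C₂ + 20) * V ^ d₂) := by
          apply Nat.mul_le_mul_left
          rw [add_mul]; omega
      _ = _ := by ring
  have e4 : 1 ≤ V ^ (d₁ + (d₂ + 1) + d₃) := Nat.one_le_pow _ _ hV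
  rw [add_mul, add_mul, add_mul]
  omega

end RAM

/-! ### Encodings of instances, and correctness of the program -/

theorem Formula.slotsOf_eq (φ : Formula) {m : RAM.Memory}
    (hm : m 0 = fun i => φ.encode.getD i 0) : RAM.Tm.slotsOf m = φ.slots := by
  have : φ.encode.getD 1 0 = φ.M := by simp [Formula.encode]
  rw [RAM.Tm.slotsOf, hm, Formula.slots]
  dsimp only
  rw [this]

namespace CapSoR

variable (I : CapSoR)

theorem encode_eq : I.encode = [I.n, I.k, I.U] ++
    List.ofFn fun u : Fin (I.n * I.n) => I.dist u.divNat u.modNat := by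
  rw [encode, List.ofFn_mul]
  congr 3
  funext i
  congr 1
  funext j
  have h1 : (⟨i * I.n + j, by
      calc (i : ℕ) * I.n + j < (i + 1) * I.n := by rw [add_mul]; omega
        _ ≤ I.n * I.n := Nat.mul_le_mul_right _ i.2⟩ : Fin (I.n * I.n)).divNat = i := by
    apply Fin.ext
    simp only [Fin.divNat]
    rw [mul_comm, Nat.mul_add_div I.n_pos, Nat.div_eq_of_lt j.2, add_zero]
  have h2 : (⟨i * I.n + j, by
      calc (i : ℕ) * I.n + j < (i + 1) * I.n := by rw [add_mul]; omega
        _ ≤ I.n * I.n := Nat.mul_le_mul_right _ i.2⟩ : Fin (I.n * I.n)).modNat = j := by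
    apply Fin.ext
    simp only [Fin.modNat]
    rw [mul_comm, Nat.mul_add_mod, Nat.mod_eq_of_lt j.2]
  rw [h1, h2]

theorem length_encode : I.encode.length = 3 + I.n * I.n := by
  rw [encode_eq]
  simp
  omega

theorem encode_getD_dist {u : ℕ} (hu : u < I.n * I.n) :
    I.encode.getD (3 + u) 0 = I.dist (Fin.divNat ⟨u, hu⟩) (Fin.modNat ⟨u, hu⟩) := by
  rw [encode_eq, List.getD_eq_getElem?_getD, List.getElem?_append_right (by simp)]
  simp only [List.length_cons, List.length_nil, Nat.zero_add, Nat.reduceAdd,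
    Nat.add_sub_cancel_left, List.getElem?_ofFn, hu, dite_true, Option.getD_some]

/-- If all numbers in the encoding of an instance and its length are at most `V`, then its size is
at most `2 * V ^ 2`. -/
theorem size_le {V : ℕ} (hlen : 3 + I.n * I.n ≤ V) (hk : I.k ≤ V) (hU : I.U ≤ V)
    (hd : ∀ p q, I.dist p q ≤ V) : I.size ≤ 2 * V ^ 2 := by
  have hn : I.n ≤ V := by have := Nat.le_mul_self I.n; omega
  have hmem : ∀ x ∈ I.encode, Nat.size x + 1 ≤ V + 1 := by
    intro x hx
    have hxV : x ≤ V := by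
      rw [encode_eq] at hx
      simp only [List.mem_append, List.mem_cons, List.not_mem_nil, or_false, List.mem_ofFn] at hx
      rcases hx with (rfl | rfl | rfl) | ⟨u, rfl⟩
      · exact hn
      · exact hk
      · exact hU
      · exact hd _ _
    exact Nat.succ_le_succ ((Nat.size_le.2 x.lt_two_pow_self).trans hxV)
  have h := List.sum_le_card_nsmul (I.encode.map fun x => Nat.size x + 1) (V + 1)
    (by simpa using hmem)
  rw [List.length_map, length_encode, smul_eq_mul] at h
  calc I.size ≤ (3 + I.n * I.n) * (V + 1) := h
    _ ≤ V * (V + V) := Nat.mul_le_mul hlen (by omega)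
    _ = 2 * V ^ 2 := by ring

theorem one_le_size : 1 ≤ I.size := by
  rw [size, encode]
  simp
  omega

open Classical in
/-- The number of clusters of radius `2` of the solution that the memory describes. -/
noncomputable def farCount (m : RAM.Memory) : ℕ :=
  ((Finset.univ : Finset (Fin I.n)).filter fun s : Fin I.n =>
    ∃ p : Fin I.n, m 1 p = (s : ℕ) ∧ I.dist p s = 2).card

theorem Solution.Describes.farCount_eq {I : CapSoR} {x : I.Solution} {m : RAM.Memory}
    (h : x.Describes m) : I.farCount m = x.far.card := by
  unfold farCount Solution.far
  congr 1
  ext s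
  simp only [Finset.mem_filter, Finset.mem_univ, true_and, (h _).1, Fin.val_inj]

end CapSoR

namespace RAM

open Tm

/-- The program maps outputs of `c` on the gap instance to the answer of the final test. -/
theorem Yields.program {k B Q V : ℕ} (hk : 0 < k) (hB : 0 < B) {c : Cmd} {φ : Formula}
    (hV : ∀ m : Memory, m 0 = (fun i => φ.encode.getD i 0) → Fits k B V m) (hQ : Q ≤ V)
    (hlen : 3 + ((SlotTable.sizes_good (T := φ.slots) hk hB).inst (φ.slots.cov k)).n *
      ((SlotTable.sizes_good (T := φ.slots) hk hB).inst (φ.slots.cov k)).n ≤ V)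
    {ω : Coins} {T : ℝ} {P : Memory → Prop}
    (h : Yields c ((SlotTable.sizes_good (T := φ.slots) hk hB).inst (φ.slots.cov k)).encode
      ω T P) :
    Yields (program k B Q c) φ.encode ω (T + overhead k B Q V) fun m => ∃ m₁, P m₁ ∧
      (m 1 0 ≠ 0 ↔ Q * ((SlotTable.sizes_good (T := φ.slots) hk hB).inst
        (φ.slots.cov k)).farCount m₁ ≤ φ.slots.K k) := by
  set I := (SlotTable.sizes_good (T := φ.slots) hk hB).inst (φ.slots.cov k) with hI
  have hIn : I.n = (φ.slots.sizes k B).K * (φ.slots.sizes k B).U := rfl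
  obtain ⟨⟨mc, pc⟩, tc, hc, htc, hP⟩ := h
  obtain ⟨m₁, t₁, h₁, ht₁, hm₁, h₁3⟩ := fill_spec ω 0 V (3 + I.n * I.n) (tlength k B)
    (tentry k B) (fun j => I.encode.getD j 0) (fun i => φ.encode.getD i 0)
    (by
      intro m hm
      refine ⟨?_, bdd_tlength (hV m hm)⟩
      simp only [tlength, eval_add, eval_const, eval_mul, eval_tn, φ.slotsOf_eq hm, hIn])
    (by
      intro m hm j hj
      refine ⟨?_, bdd_tentry (hV m hm) (hj.le.trans hlen)⟩
      rw [tentry, eval_ite_holds, eval_ite_holds, eval_ite_holds]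
      simp only [holds_lt, holds_eq, eval_var, eval_const, eval_tn, eval_tK, eval_tU, eval_tdist,
        eval_div, eval_mod, eval_sub, φ.slotsOf_eq hm]
      split_ifs with h3 h0 h1
      · subst h0
        rfl
      · subst h1
        rfl
      · obtain rfl : j = 2 := by omega
        rfl
      · obtain ⟨u, rfl⟩ : ∃ u, j = 3 + u := ⟨j - 3, by omega⟩
        rw [I.encode_getD_dist (by omega), Nat.add_sub_cancel_left]
        rfl)
    (init φ.encode).mem rfl (fun i => by simp [init])
  -- the block of arrays from `3` on is the initial memory for `c`
  have habove : m₁ = m₁.above (init I.encode).mem := by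
    funext a i
    match a with
    | 0 => rfl
    | 1 => rfl
    | 2 => rfl
    | 3 =>
      rw [h₁3]
      change _ = I.encode.getD i 0
      split_ifs with hi
      · rfl
      · rw [List.getD_eq_default]
        rw [I.length_encode]
        omega
    | a + 4 =>
      rw [hm₁ _ (by omega) (by omega)]
      simp [Memory.above, init]
  have h₂ := hc.shift m₁
  change Exec ω c.shift ⟨m₁.above (init I.encode).mem, 0⟩ ⟨m₁.above mc, pc⟩ tc at h₂
  rw [← habove] at h₂
  have hm₂ : (m₁.above mc) 0 = fun i => φ.encode.getD i 0 := by
    change m₁ 0 = _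
    rw [hm₁ 0 (by omega) (by omega)]
    rfl
  obtain ⟨m₃, t₃, h₃, ht₃, hv₃, hm₃, -⟩ := compile_spec ω pc V (m₁.above mc) (tanswer k B Q) 1
    (fun _ => 0) (fun _ => (m₁.above mc) 2 0) (m₁.above mc) (fun _ => by omega) (fun _ _ => rfl)
    (fun _ => rfl) (bdd_tanswer (hV _ hm₂) hQ)
  refine ⟨_, _, .seq h₁ (.seq h₂ (.seq h₃ (.store _ _ _ _))), ?_, mc, hP, ?_⟩
  · have h4 : (3 + I.n * I.n) * ((tentry k B).time V + 20) ≤ V * ((tentry k B).time V + 20) :=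
      Nat.mul_le_mul_right _ hlen
    have h5 : t₁ + (t₃ + 4) ≤ overhead k B Q V := by
      unfold overhead
      omega
    have h6 : ((t₁ + (t₃ + 4) : ℕ) : ℝ) ≤ overhead k B Q V := by exact_mod_cast h5
    simp only [Expr.cost]
    push_cast at h6 ⊢
    linarith
  · have hfar : (tfar k B).eval (m₁.above mc) (fun _ => (m₁.above mc) 2 0) = I.farCount mc := by
      rw [eval_tfar, φ.slotsOf_eq hm₂, CapSoR.farCount, ← hIn,
        ← Finset.card_image_of_injective _ Fin.val_injective]
      congr 1
      ext s
      simp only [Finset.mem_filter, Finset.mem_range, Finset.mem_image, Finset.mem_univ, true_and]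
      constructor
      · rintro ⟨hs, p, hp, h1, h2⟩
        exact ⟨⟨s, hs⟩, ⟨⟨p, hp⟩, h1, h2⟩, rfl⟩
      · rintro ⟨⟨s, hs⟩, ⟨⟨p, hp⟩, h1, h2⟩, rfl⟩
        exact ⟨hs, p, hp, h1, h2⟩
    have hans : (tanswer k B Q).eval (m₁.above mc) (fun _ => (m₁.above mc) 2 0) ≠ 0 ↔
        Q * I.farCount mc ≤ φ.slots.K k := by
      rw [tanswer, eval_ite, eval_sub, eval_mul, eval_const, eval_tK, hfar, φ.slotsOf_eq hm₂]
      split_ifs with h <;> simp only [eval_const] <;> omega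
    rw [← hans, ← hv₃]
    simp [Memory.write, Expr.eval]

end RAM

/-! ### The size of the gap instance -/

namespace SlotTable

variable {T : SlotTable} {k B Q : ℕ}

/-- A bound on the loops of the reduction. -/
def loopBound (T : SlotTable) (k B Q : ℕ) : ℕ :=
  3 * (((T.sizes k B).K * (T.sizes k B).U) * ((T.sizes k B).K * (T.sizes k B).U)) + 3 * B + Q + 5

theorem le_loopBound {x : ℕ}
    (hx : x ≤ (T.sizes k B).K * (T.sizes k B).U) : 3 * x + 2 ≤ T.loopBound k B Q := by
  have h := Nat.le_mul_self ((T.sizes k B).K * (T.sizes k B).U)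
  unfold loopBound
  omega

theorem D_le_U (hk : 0 < k) (hB : 0 < B) :
    (T.sizes k B).D ≤ (T.sizes k B).U ∧ (T.sizes k B).W ≤ (T.sizes k B).U := by
  have hg := sizes_good (T := T) hk hB
  have h1 : (T.sizes k B).W ≤ (T.sizes k B).W * (T.sizes k B).D :=
    Nat.le_mul_of_pos_right _ hg.D_pos
  have h2 : (T.sizes k B).D ≤ (T.sizes k B).W * (T.sizes k B).D :=
    Nat.le_mul_of_pos_left _ hg.W_pos
  unfold Sizes.U
  omega

theorem fits (hk : 0 < k) (hB : 0 < B) {m : RAM.Memory} (hm : RAM.Tm.slotsOf m = T) :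
    RAM.Tm.Fits k B (T.loopBound k B Q) m := by
  have hg := sizes_good (T := T) hk hB
  obtain ⟨hD, hW⟩ := D_le_U (T := T) hk hB
  have hUn : (T.sizes k B).U ≤ (T.sizes k B).K * (T.sizes k B).U :=
    Nat.le_mul_of_pos_left _ hg.K_pos
  have hsD : T.s k ≤ (T.sizes k B).D := Nat.le_mul_of_pos_left _ (by omega)
  have hKn : T.K k ≤ (T.sizes k B).K * (T.sizes k B).U := Nat.le_mul_of_pos_right _ hg.U_pos
  have hMn : T.M ≤ (T.sizes k B).K * (T.sizes k B).U :=
    (M_le hk hB).trans (Nat.mul_le_mul_left _ hD)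
  subst hm
  refine ⟨?_, le_loopBound hMn, ?_, ?_, ?_, ?_⟩
  · unfold loopBound
    omega
  · have := le_loopBound (Q := Q) (hsD.trans (hD.trans hUn))
    omega
  · have := le_loopBound (Q := Q) hKn
    omega
  · have := le_loopBound (Q := Q) (hW.trans hUn)
    omega
  · have := le_loopBound (Q := Q)
      (le_refl (((RAM.Tm.slotsOf m).sizes k B).K * ((RAM.Tm.slotsOf m).sizes k B).U))
    omega

theorem loopBound_le : T.loopBound k B Q ≤
    (147 * k ^ 4 * (B + 1) ^ 2 + 3 * B + Q + 5) * (2 ^ (3 * T.s k)) ^ 4 := by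
  obtain ⟨L, hL⟩ : ∃ L, L = 2 ^ (3 * T.s k) := ⟨_, rfl⟩
  have hL1 : 1 ≤ L := hL ▸ Nat.one_le_two_pow
  have hsL : 3 * T.s k ≤ L := hL ▸ Nat.lt_two_pow_self.le
  have hK : T.K k ≤ k := min_le_left _ _
  have hn : (T.sizes k B).K * (T.sizes k B).U ≤ 7 * k ^ 2 * (B + 1) * L ^ 2 := by
    by_cases hk : k = 0
    · have : T.K k = 0 := by omega
      simp [sizes, this]
    have hWD : (T.sizes k B).W * (T.sizes k B).D ≤ k * L * ((B + 1) * L) := by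
      simp only [sizes, ← hL]
      refine Nat.mul_le_mul (Nat.mul_le_mul_right _ hK) ?_
      calc 3 * B * T.s k = B * (3 * T.s k) := by ring
        _ ≤ (B + 1) * L := Nat.mul_le_mul (by omega) hsL
    have hU : (T.sizes k B).U ≤ 3 * (k * L * ((B + 1) * L)) := by
      have h1 : (T.sizes k B).L = L := hL.symm
      have h2 : L ≤ k * L * ((B + 1) * L) := by
        calc L = 1 * L * (1 * 1) := by ring
          _ ≤ _ := Nat.mul_le_mul (Nat.mul_le_mul_right _ (by omega))
            (Nat.mul_le_mul (by omega) hL1)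
      unfold Sizes.U
      omega
    calc (T.sizes k B).K * (T.sizes k B).U ≤ k * (3 * (k * L * ((B + 1) * L))) :=
          Nat.mul_le_mul hK hU
      _ = 3 * (k ^ 2 * (B + 1) * L ^ 2) := by ring
      _ ≤ 7 * (k ^ 2 * (B + 1) * L ^ 2) := Nat.mul_le_mul_right _ (by norm_num)
      _ = _ := by ring
  have h4 : 1 ≤ L ^ 4 := Nat.one_le_pow _ _ hL1
  have hnn := Nat.mul_le_mul hn hn
  rw [← hL]
  unfold loopBound
  have e1 : 3 * (7 * k ^ 2 * (B + 1) * L ^ 2 * (7 * k ^ 2 * (B + 1) * L ^ 2)) =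
      147 * k ^ 4 * (B + 1) ^ 2 * L ^ 4 := by ring
  have e2 : 3 * B + Q + 5 ≤ (3 * B + Q + 5) * L ^ 4 := Nat.le_mul_of_pos_right _ h4
  rw [show 147 * k ^ 4 * (B + 1) ^ 2 + 3 * B + Q + 5 =
    147 * k ^ 4 * (B + 1) ^ 2 + (3 * B + Q + 5) by ring, add_mul]
  omega

end SlotTable

/-! ### The gap instance of a formula -/

namespace Formula

variable (φ : Formula) {k B Q : ℕ}

/-- The gap instance of a formula. -/
noncomputable def gapInst (hk : 0 < k) (hB : 0 < B) : CapSoR :=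
  (SlotTable.sizes_good (T := φ.slots) hk hB).inst (φ.slots.cov k)

theorem gapInst_tight (hk : 0 < k) (hB : 0 < B) :
    (φ.gapInst hk hB).n = (φ.gapInst hk hB).k * (φ.gapInst hk hB).U := rfl

theorem gapInst_k (hk : 0 < k) (hB : 0 < B) : (φ.gapInst hk hB).k = φ.slots.K k := rfl

theorem two_le_gapInst_U (hk : 0 < k) (hB : 0 < B) : 2 ≤ (φ.gapInst hk hB).U :=
  (Nat.le_add_left 2 _).trans (SlotTable.sizes_good (T := φ.slots) hk hB).lt_U

theorem gapInst_length_le (hk : 0 < k) (hB : 0 < B) :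
    3 + (φ.gapInst hk hB).n * (φ.gapInst hk hB).n ≤ φ.slots.loopBound k B Q := by
  change 3 + ((φ.slots.sizes k B).K * (φ.slots.sizes k B).U) *
    ((φ.slots.sizes k B).K * (φ.slots.sizes k B).U) ≤ _
  unfold SlotTable.loopBound
  omega

theorem gapInst_size_le (hk : 0 < k) (hB : 0 < B) :
    (φ.gapInst hk hB).size ≤ 2 * φ.slots.loopBound k B Q ^ 2 := by
  have hg := SlotTable.sizes_good (T := φ.slots) hk hB
  refine CapSoR.size_le _ (φ.gapInst_length_le hk hB) ?_ ?_ fun p q => ?_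
  · have := SlotTable.le_loopBound (Q := Q)
      (Nat.le_mul_of_pos_right (φ.slots.sizes k B).K hg.U_pos)
    change (φ.slots.sizes k B).K ≤ _
    omega
  · have := SlotTable.le_loopBound (Q := Q)
      (Nat.le_mul_of_pos_left (φ.slots.sizes k B).U hg.K_pos)
    change (φ.slots.sizes k B).U ≤ _
    omega
  · refine (Sizes.dist_le_two _ _ _).trans ?_
    unfold SlotTable.loopBound
    omega

/-- If the formula is satisfiable, then a nearly optimal solution has few clusters of radius `2`. -/
theorem farCount_le_of_sat (hk : 0 < k) (hB : 0 < B) (hQ : 0 < Q)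
    (hocc : ∀ v, φ.occurrences v ≤ B) (hsat : ∃ a, φ.satCount a = φ.M) {m : RAM.Memory}
    (hm : ∃ x : (φ.gapInst hk hB).Solution, x.Describes m ∧ x.IsApprox (1 + 1 / (Q : ℝ))) :
    Q * (φ.gapInst hk hB).farCount m ≤ φ.slots.K k := by
  obtain ⟨x, hxm, hx, happ⟩ := hm
  obtain ⟨a, ha⟩ := hsat
  obtain ⟨y, hy, hycost⟩ := SlotTable.exists_solution_of_sat (T := φ.slots) hk hB
    (α := fun v => if h : v < φ.N then a ⟨v, h⟩ else false)
    (by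
      intro c hc
      refine (φ.sat_slots hc _).2 ?_
      have h1 : Finset.univ.filter (fun j : Fin φ.M =>
          ∃ l, a (φ.clause j l).1 = (φ.clause j l).2) = Finset.univ :=
        (Finset.card_eq_iff_eq_univ _).1 (ha.trans (Fintype.card_fin _).symm)
      have h2 := Finset.mem_univ (⟨c, hc⟩ : Fin φ.M)
      rw [← h1, Finset.mem_filter] at h2
      simpa using h2.2)
    (φ.occurrences_slots hocc)
  have h1 := happ y hy
  have h2 := hx.le_cost (φ.gapInst_tight hk hB) (φ.two_le_gapInst_U hk hB)
  rw [φ.gapInst_k hk hB] at h2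
  rw [hxm.farCount_eq]
  have hQ' : (0 : ℝ) < Q := by exact_mod_cast hQ
  have h3 : ((φ.slots.K k : ℝ) + x.far.card) ≤ (1 + 1 / (Q : ℝ)) * φ.slots.K k := by
    calc ((φ.slots.K k : ℝ) + x.far.card) ≤ x.cost := by exact_mod_cast h2
      _ ≤ _ := h1
      _ ≤ _ := mul_le_mul_of_nonneg_left (by exact_mod_cast hycost) (by positivity)
  have h4 : (x.far.card : ℝ) ≤ 1 / (Q : ℝ) * φ.slots.K k := by linarith
  have h5 : (Q : ℝ) * x.far.card ≤ φ.slots.K k := by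
    calc (Q : ℝ) * x.far.card ≤ Q * (1 / (Q : ℝ) * φ.slots.K k) := by gcongr
      _ = φ.slots.K k := by field_simp
  exact_mod_cast h5

/-- If no assignment satisfies almost all clauses, then every solution has many clusters of
radius `2`. -/
theorem lt_farCount_of_gap (hk : 0 < k) (hB : 0 < B) {ε : ℝ} (hQ : 81 * (B : ℝ) ≤ ε * Q)
    (hgap : ∀ a, (φ.satCount a : ℝ) < (1 - ε) * φ.M) {m : RAM.Memory}
    (hm : ∃ x : (φ.gapInst hk hB).Solution, x.Describes m ∧ x.Feasible) :
    ¬ Q * (φ.gapInst hk hB).farCount m ≤ φ.slots.K k := by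
  classical
  intro hle
  obtain ⟨x, hxm, hx⟩ := hm
  rw [hxm.farCount_eq] at hle
  obtain ⟨α, hα⟩ := SlotTable.exists_assignment (T := φ.slots) hk hB (fun t => φ.sgn_slots_le) hx
  have hα' : ((Finset.range φ.M).filter fun c => ¬ φ.slots.Sat α c).card ≤
      9 * x.far.card * (3 * B * φ.slots.s k) :=
    le_of_eq_of_le (by congr) hα
  have hg := hgap fun v => α v
  have hsum : φ.satCount (fun v => α v) +
      ((Finset.range φ.M).filter fun c => ¬ φ.slots.Sat α c).card = φ.M := by
    rw [φ.card_filter_slots fun c => ¬ φ.slots.Sat α c, satCount]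
    have : (Finset.univ.filter fun j : Fin φ.M =>
        ∃ l, α (φ.clause j l).1 = (φ.clause j l).2) =
        Finset.univ.filter fun j : Fin φ.M => φ.slots.Sat α j := by
      ext j
      simp only [Finset.mem_filter, Finset.mem_univ, true_and]
      exact (φ.sat_slots j.2 α).symm
    rw [this, Finset.card_filter_add_card_filter_not]
    simp
  have hMpos : 0 < φ.M := by
    rcases Nat.eq_zero_or_pos φ.M with h | h
    · rw [h] at hg
      have : (0 : ℝ) ≤ φ.satCount fun v => α v := Nat.cast_nonneg _
      simp at hg
      linarith
    · exact h
  have hKs : φ.slots.K k * φ.slots.s k ≤ 3 * φ.M := by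
    have := SlotTable.K_mul_s_le (T := φ.slots) k
    have : φ.slots.M = φ.M := rfl
    omega
  obtain ⟨u, hu⟩ : ∃ u, u = ((Finset.range φ.M).filter fun c => ¬ φ.slots.Sat α c).card :=
    ⟨_, rfl⟩
  rw [← hu] at hα' hsum
  have hQu : Q * u ≤ 81 * B * φ.M := by
    calc Q * u ≤ Q * (9 * x.far.card * (3 * B * φ.slots.s k)) := Nat.mul_le_mul_left _ hα'
      _ = 27 * B * ((Q * x.far.card) * φ.slots.s k) := by ring
      _ ≤ 27 * B * (φ.slots.K k * φ.slots.s k) := by gcongr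
      _ ≤ 27 * B * (3 * φ.M) := by gcongr
      _ = _ := by ring
  have hQu' : (Q : ℝ) * u ≤ 81 * B * φ.M := by exact_mod_cast hQu
  have hQpos : (0 : ℝ) < Q := by
    rcases Nat.eq_zero_or_pos Q with h | h
    · rw [h] at hQ
      have : (0 : ℝ) < B := by exact_mod_cast hB
      norm_num at hQ
      linarith
    · exact_mod_cast h
  have hsum' : (φ.satCount (fun v => α v) : ℝ) + u = φ.M := by exact_mod_cast hsum
  have h1 : ε * φ.M < u := by linarith
  have h2 : (Q : ℝ) * (ε * φ.M) < Q * u := by gcongr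
  have h3 : 81 * (B : ℝ) * φ.M ≤ ε * Q * φ.M := by gcongr
  linarith

/-- The length of the assignments of a group is at most the `k`-th part of the number of
variables, up to constants. -/
theorem two_pow_s_le (hk : 0 < k) (hocc : ∀ v, φ.occurrences v ≤ B) :
    (2 : ℝ) ^ (3 * φ.slots.s k) ≤ 8 * (2 : ℝ) ^ (3 * B / k * φ.N : ℝ) := by
  have hk' : (0 : ℝ) < k := by exact_mod_cast hk
  have hN : (0 : ℝ) ≤ 3 * B / k * φ.N := by positivity
  have hs : (3 * φ.slots.s k : ℝ) ≤ 3 + 3 * B / k * φ.N := by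
    have hM : (φ.M : ℝ) ≤ B * φ.N := by exact_mod_cast φ.M_le_of_occurrences hocc
    have hdiv : ((φ.M / φ.slots.K k : ℕ) : ℝ) ≤ B / k * φ.N := by
      rcases le_total k (φ.M + 1) with h | h
      · have hK : φ.slots.K k = k := min_eq_left h
        rw [hK]
        calc ((φ.M / k : ℕ) : ℝ) ≤ φ.M / k := Nat.cast_div_le
          _ ≤ B * φ.N / k := by gcongr
          _ = _ := by ring
      · have hK : φ.slots.K k = φ.M + 1 := min_eq_right h
        rw [hK, Nat.div_eq_of_lt (Nat.lt_succ_self _)]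
        simp only [Nat.cast_zero]
        positivity
    have : (φ.slots.s k : ℝ) = ((φ.M / φ.slots.K k : ℕ) : ℝ) + 1 := by
      rw [SlotTable.s]
      push_cast
      rfl
    rw [this]
    have e : (3 * B / k * φ.N : ℝ) = 3 * (B / k * φ.N) := by ring
    rw [e]
    linarith
  calc (2 : ℝ) ^ (3 * φ.slots.s k) = (2 : ℝ) ^ (3 * φ.slots.s k : ℝ) := by
        rw [← Real.rpow_natCast]
        push_cast
        rfl
    _ ≤ (2 : ℝ) ^ (3 + 3 * B / k * φ.N : ℝ) := Real.rpow_le_rpow_of_exponent_le (by norm_num) hs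
    _ = _ := by
      rw [Real.rpow_add (by norm_num)]
      norm_num

end Formula

/-! ### The running time -/

/-- Powers of `C * 2 ^ (x * N)` are again exponential in `N`. -/
theorem rpow_const_mul_two_rpow_le {C x y τ N : ℝ} (hC : 0 ≤ C) (hN : 0 ≤ N) (h : x * y ≤ τ) :
    (C * (2 : ℝ) ^ (x * N)) ^ y ≤ C ^ y * (2 : ℝ) ^ (τ * N) := by
  rw [Real.mul_rpow hC (by positivity), ← Real.rpow_mul (by norm_num)]
  have : x * N * y ≤ τ * N := by nlinarith
  gcongr
  norm_num

/-- If `k` is large, then an algorithm that takes time `f K * n ^ e K` on the gap instances, where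
`K ≤ k` is the number of clusters, takes time `O(2 ^ (τ * N))` together with the reduction. -/
theorem exists_time_bound {B Q k : ℕ} (hk : 0 < k) (hB : 0 < B) {C d : ℕ} {τ : ℝ} {f e : ℕ → ℝ}
    (hd : 12 * B * d ≤ τ * k) (he : 24 * B * |e k| ≤ τ * k) :
    ∃ C' : ℝ, ∀ φ : Formula, (∀ v, φ.occurrences v ≤ B) →
      f (φ.gapInst hk hB).k * ((φ.gapInst hk hB).size : ℝ) ^ e (φ.gapInst hk hB).k +
        ((C * φ.slots.loopBound k B Q ^ d : ℕ) : ℝ) ≤ C' * (2 : ℝ) ^ (τ * (φ.N : ℝ)) := by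
  have hk' : (0 : ℝ) < k := by exact_mod_cast hk
  have hτ : 0 ≤ τ := by
    have h0 : 0 ≤ τ * k := le_trans (by positivity) hd
    exact nonneg_of_mul_nonneg_left h0 hk'
  -- constants for the loop bound and for the size of the instance
  let C₁ : ℝ := 147 * (k : ℝ) ^ 4 * (B + 1) ^ 2 + 3 * B + Q + 5
  let Z : ℝ := 2 * C₁ ^ 2 * 8 ^ 8
  have hC₁ : 1 ≤ C₁ := by
    have : (0 : ℝ) ≤ 147 * (k : ℝ) ^ 4 * (B + 1) ^ 2 + 3 * B + Q := by positivity
    simp only [C₁]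
    linarith
  have hZ : 0 ≤ Z := by positivity
  refine ⟨(∑ j ∈ Finset.range (k + 1), |f j| * Z ^ |e j|) + C * (C₁ * 8 ^ 4) ^ d, ?_⟩
  intro φ hocc
  set N : ℝ := (φ.N : ℝ)
  have hN : 0 ≤ N := Nat.cast_nonneg _
  have h2 : (1 : ℝ) ≤ 2 ^ (τ * N) := Real.one_le_rpow (by norm_num) (by positivity)
  set I := φ.gapInst hk hB
  set V := φ.slots.loopBound k B Q
  have hV : (V : ℝ) ≤ C₁ * ((2 : ℝ) ^ (3 * φ.slots.s k)) ^ 4 := by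
    have : (V : ℝ) ≤ _ := Nat.cast_le.2 φ.slots.loopBound_le
    push_cast at this
    exact this
  have hsize : (I.size : ℝ) ≤ 2 * (V : ℝ) ^ 2 := by
    exact_mod_cast φ.gapInst_size_le (Q := Q) hk hB
  have hone : (1 : ℝ) ≤ I.size := by exact_mod_cast I.one_le_size
  have hIk : I.k = φ.slots.K k := φ.gapInst_k hk hB
  have hKk : I.k ≤ k := hIk ▸ min_le_left _ _
  have hL := φ.two_pow_s_le hk hocc
  have hpow : ∀ j : ℕ, ((2 : ℝ) ^ (3 * B / k * N : ℝ)) ^ j = (2 : ℝ) ^ ((3 * B / k * j) * N) := by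
    intro j
    rw [← Real.rpow_natCast, ← Real.rpow_mul (by norm_num)]
    ring_nf
  -- the time for the reduction
  have hover : ((C * V ^ d : ℕ) : ℝ) ≤ C * (C₁ * 8 ^ 4) ^ d * (2 : ℝ) ^ (τ * N) := by
    have h1 : (V : ℝ) ≤ C₁ * 8 ^ 4 * (2 : ℝ) ^ ((3 * B / k * (4 : ℕ)) * N) := by
      calc (V : ℝ) ≤ C₁ * ((2 : ℝ) ^ (3 * φ.slots.s k)) ^ 4 := hV
        _ ≤ C₁ * (8 * (2 : ℝ) ^ (3 * B / k * N : ℝ)) ^ 4 := by gcongr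
        _ = _ := by rw [mul_pow, hpow]; exact (mul_assoc _ _ _).symm
    have h3 := rpow_const_mul_two_rpow_le (C := C₁ * 8 ^ 4) (x := 3 * B / k * (4 : ℕ)) (y := d)
      (τ := τ) (N := N) (by positivity) hN (by
        rw [show (3 * B / k * (4 : ℕ) * d : ℝ) = 12 * B * d / k by push_cast; ring,
          div_le_iff₀ hk']
        exact hd)
    rw [Real.rpow_natCast, Real.rpow_natCast] at h3
    push_cast
    calc (C : ℝ) * (V : ℝ) ^ d ≤
          C * (C₁ * 8 ^ 4 * (2 : ℝ) ^ ((3 * B / k * (4 : ℕ)) * N)) ^ d := by gcongr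
      _ ≤ C * ((C₁ * 8 ^ 4) ^ d * (2 : ℝ) ^ (τ * N)) := by gcongr
      _ = _ := by ring
  -- the time for the algorithm on the instance
  have halg : f I.k * (I.size : ℝ) ^ e I.k ≤ |f I.k| * Z ^ |e I.k| * (2 : ℝ) ^ (τ * N) := by
    have h1 : (I.size : ℝ) ^ e I.k ≤ (I.size : ℝ) ^ |e I.k| :=
      Real.rpow_le_rpow_of_exponent_le hone (le_abs_self _)
    have h3 : (I.size : ℝ) ^ |e I.k| ≤ Z ^ |e I.k| * (2 : ℝ) ^ (τ * N) := by
      rcases le_total k (φ.slots.M + 1) with h | h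
      · have hK : I.k = k := hIk.trans (min_eq_left h)
        have hs : (I.size : ℝ) ≤ Z * (2 : ℝ) ^ ((3 * B / k * (8 : ℕ)) * N) := by
          calc (I.size : ℝ) ≤ 2 * (V : ℝ) ^ 2 := hsize
            _ ≤ 2 * (C₁ * (8 * (2 : ℝ) ^ (3 * B / k * N : ℝ)) ^ 4) ^ 2 := by
              gcongr
              exact hV.trans (by gcongr)
            _ = 2 * C₁ ^ 2 * 8 ^ 8 * ((2 : ℝ) ^ (3 * B / k * N : ℝ)) ^ 8 := by ring
            _ = _ := by rw [hpow]
        refine (Real.rpow_le_rpow (by positivity) hs (abs_nonneg _)).trans ?_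
        refine rpow_const_mul_two_rpow_le hZ hN ?_
        rw [hK, show (3 * B / k * (8 : ℕ) * |e k| : ℝ) = 24 * B * |e k| / k by push_cast; ring,
          div_le_iff₀ hk']
        exact he
      · -- with fewer clauses than groups, the size of the instance is bounded
        have hK : φ.slots.K k = φ.slots.M + 1 := min_eq_right h
        have hs1 : φ.slots.s k = 1 := by
          rw [SlotTable.s, hK, Nat.div_eq_of_lt (Nat.lt_succ_self _)]
        have hs : (I.size : ℝ) ≤ Z := by
          rw [hs1] at hV
          calc (I.size : ℝ) ≤ 2 * (V : ℝ) ^ 2 := hsize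
            _ ≤ 2 * (C₁ * ((2 : ℝ) ^ (3 * 1)) ^ 4) ^ 2 := by gcongr
            _ = Z := by simp only [Z]; ring
        calc (I.size : ℝ) ^ |e I.k| ≤ Z ^ |e I.k| :=
              Real.rpow_le_rpow (by positivity) hs (abs_nonneg _)
          _ ≤ _ := le_mul_of_one_le_right (by positivity) h2
    calc f I.k * (I.size : ℝ) ^ e I.k ≤ |f I.k| * (I.size : ℝ) ^ e I.k :=
          mul_le_mul_of_nonneg_right (le_abs_self _) (by positivity)
      _ ≤ |f I.k| * (Z ^ |e I.k| * (2 : ℝ) ^ (τ * N)) :=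
          mul_le_mul_of_nonneg_left (h1.trans h3) (abs_nonneg _)
      _ = _ := by ring
  have hterm : |f I.k| * Z ^ |e I.k| ≤ ∑ j ∈ Finset.range (k + 1), |f j| * Z ^ |e j| :=
    Finset.single_le_sum (f := fun j => |f j| * Z ^ |e j|) (fun j _ => by positivity)
      (Finset.mem_range.2 (by omega))
  calc f I.k * (I.size : ℝ) ^ e I.k + ((C * V ^ d : ℕ) : ℝ) ≤
        |f I.k| * Z ^ |e I.k| * (2 : ℝ) ^ (τ * N) +
          C * (C₁ * 8 ^ 4) ^ d * (2 : ℝ) ^ (τ * N) := add_le_add halg hover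
    _ ≤ _ := (add_le_add (mul_le_mul_of_nonneg_right hterm (zero_le_one.trans h2))
      le_rfl).trans_eq (add_mul _ _ _).symm

/-! ### From approximation to the gap problem -/

theorem RAM.Yields.mono {c : RAM.Cmd} {input : List ℕ} {ω : RAM.Coins} {T T' : ℝ}
    {P P' : RAM.Memory → Prop} (h : RAM.Yields c input ω T P) (hT : T ≤ T')
    (hP : ∀ m, P m → P' m) : RAM.Yields c input ω T' P' := by
  obtain ⟨s, t, he, ht, hs⟩ := h
  exact ⟨s, t, he, ht.trans hT, hP _ hs⟩

/-- An approximation algorithm decides the gap problem. -/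
theorem distinguishes_of_approximates {B Q k : ℕ} (hk : 0 < k) (hB : 0 < B) (hQ : 0 < Q)
    {ε : ℝ} (hε : 81 * (B : ℝ) ≤ ε * Q) {c : RAM.Cmd} {T : CapSoR → ℝ} {T' : Formula → ℝ}
    (hc : ApproximatesCapSoR c (1 + 1 / (Q : ℝ)) T)
    (hT : ∀ φ : Formula, (∀ v, φ.occurrences v ≤ B) → T (φ.gapInst hk hB) +
      (RAM.overhead k B Q (φ.slots.loopBound k B Q) : ℝ) ≤ T' φ) :
    Distinguishes (RAM.program k B Q c) B ε T' := by
  intro φ hocc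
  have hfeas : ∃ y : (φ.gapInst hk hB).Solution, y.Feasible := Sizes.Good.exists_feasible _ _
  obtain ⟨hhalt, hlikely⟩ := hc _ hfeas
  have hQV : Q ≤ φ.slots.loopBound k B Q := by
    unfold SlotTable.loopBound
    omega
  have key : ∀ (ω : RAM.Coins) (P : RAM.Memory → Prop),
      RAM.Yields c (φ.gapInst hk hB).encode ω (T (φ.gapInst hk hB)) P →
      RAM.Yields (RAM.program k B Q c) φ.encode ω (T' φ) fun m => ∃ m₁, P m₁ ∧
        (m 1 0 ≠ 0 ↔ Q * (φ.gapInst hk hB).farCount m₁ ≤ φ.slots.K k) := fun ω P h =>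
    (RAM.Yields.program hk hB (fun m hm => SlotTable.fits hk hB (φ.slotsOf_eq hm)) hQV
      (φ.gapInst_length_le hk hB) h).mono (hT φ hocc) fun _ h => h
  refine ⟨fun ω => (key ω _ (hhalt ω)).mono le_rfl fun _ _ => trivial, fun hsat => ?_,
    fun hgap => ?_⟩
  · refine hlikely.trans (measure_mono fun ω hω => ?_)
    rw [Set.mem_ofPred_eq] at hω ⊢
    refine (key ω _ hω).mono le_rfl ?_
    rintro m ⟨m₁, hm₁, hiff⟩
    exact hiff.2 (φ.farCount_le_of_sat hk hB hQ hocc hsat hm₁)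
  · refine hlikely.trans (measure_mono fun ω hω => ?_)
    rw [Set.mem_ofPred_eq] at hω ⊢
    refine (key ω _ hω).mono le_rfl ?_
    rintro m ⟨m₁, ⟨x, hx, hxa⟩, hiff⟩
    by_contra hne
    exact φ.lt_farCount_of_gap hk hB hε hgap ⟨x, hx, hxa.1⟩ (hiff.1 hne)

/-- Under the gap exponential time hypothesis, some constant factor cannot be achieved in time
`f k * n ^ o(k)`. -/
theorem exists_factor_of_gapETH (hGap : GapETH) : ∃ α : ℝ, 1 < α ∧
    ∀ (f e : ℕ → ℝ), (e =o[atTop] fun k : ℕ => (k : ℝ)) →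
      ¬ ∃ c : RAM.Cmd, ApproximatesCapSoR c α fun I => f I.k * (I.size : ℝ) ^ e I.k := by
  obtain ⟨B, ε, τ, hε, hτ, hno⟩ := hGap
  -- `B + 1` bounds the occurrences as well, and makes the sizes of the gap instance positive
  have hB : 0 < B + 1 := B.succ_pos
  have hB' : (0 : ℝ) < ((B + 1 : ℕ) : ℝ) := by exact_mod_cast hB
  obtain ⟨Q, hQ⟩ := exists_nat_ge (81 * ((B + 1 : ℕ) : ℝ) / ε)
  rw [div_le_iff₀ hε, mul_comm (Q : ℝ)] at hQ
  have hQpos : 0 < Q := Nat.pos_of_ne_zero fun h => by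
    rw [h, Nat.cast_zero, mul_zero] at hQ
    linarith
  have hQ' : (0 : ℝ) < Q := by exact_mod_cast hQpos
  refine ⟨1 + 1 / (Q : ℝ), by simpa using hQ', ?_⟩
  rintro f e he ⟨c, hc⟩
  obtain ⟨C, d, hover⟩ := RAM.overhead_le_poly
  -- a number of clusters that is large enough for the exponents in the running times
  obtain ⟨k, ⟨hek, hdk⟩, hk⟩ : ∃ k : ℕ, (‖e k‖ ≤ τ / (24 * (B + 1 : ℕ)) * ‖(k : ℝ)‖ ∧
      12 * ((B + 1 : ℕ) : ℝ) * d / τ ≤ k) ∧ 0 < k :=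
    (((he.def (c := τ / (24 * (B + 1 : ℕ))) (by positivity)).and
      (tendsto_natCast_atTop_atTop.eventually_ge_atTop _)).and (eventually_gt_atTop 0)).exists
  obtain ⟨C', hC'⟩ := exists_time_bound (B := B + 1) (Q := Q) (C := C) (d := d) (τ := τ) (f := f)
    (e := e) hk hB
    (by rwa [div_le_iff₀ hτ, mul_comm _ τ] at hdk)
    (by
      rw [Real.norm_eq_abs, Real.norm_natCast, div_mul_eq_mul_div,
        le_div_iff₀ (by positivity)] at hek
      linarith)
  have hdist : Distinguishes (RAM.program k (B + 1) Q c) (B + 1) ε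
      fun φ => C' * (2 : ℝ) ^ (τ * (φ.N : ℝ)) := by
    refine distinguishes_of_approximates hk hB hQpos hQ hc fun φ hocc => ?_
    refine le_trans ?_ (hC' φ hocc)
    have h1 : 1 ≤ φ.slots.loopBound k (B + 1) Q := by
      unfold SlotTable.loopBound
      omega
    have h2 : (RAM.overhead k (B + 1) Q (φ.slots.loopBound k (B + 1) Q) : ℝ) ≤
        ((C * φ.slots.loopBound k (B + 1) Q ^ d : ℕ) : ℝ) := by
      exact_mod_cast hover k (B + 1) Q _ h1
    linarith
  exact hno ⟨_, C', fun φ hocc => hdist φ fun v => (hocc v).trans B.le_succ⟩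

theorem mainTheorem3 (hGap : GapETH) :
    (∃ α : ℝ, 1 < α ∧
      ∀ (f e : ℕ → ℝ), (e =o[atTop] fun k : ℕ => (k : ℝ)) →
        ¬ ∃ c : RAM.Cmd,
          ApproximatesCapSoR c α fun I => f I.k * (I.size : ℝ) ^ e I.k) ∧
    ¬ HasFPTApproximationScheme := by
  have h := exists_factor_of_gapETH hGap
  refine ⟨h, ?_⟩
  obtain ⟨α, hα, hno⟩ := h
  rintro ⟨f, g, hfg⟩
  obtain ⟨c, hc⟩ := hfg (α - 1) (by linarith)
  rw [add_sub_cancel] at hc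
  refine hno (fun k => f k (α - 1)) (fun _ => g (α - 1)) ?_ ⟨c, hc⟩
  exact isLittleO_const_left.2 (.inr (tendsto_norm_atTop_atTop.comp tendsto_natCast_atTop_atTop))
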